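/- **Theorem (soundness and completeness of $\mathsf{XP}^-$ for the equality-only fragment of downward XPath).** Fix a finite set $\mathbb A$ of labels. *Path expressions* $\alpha,\beta,\gamma$ and *node expressions* $\varphi,\psi$ are given by $$\alpha,\beta ::= \varepsilon \mid {\downarrow} \mid [\varphi] \mid \alpha\beta \mid \alpha\cup\beta,\qquad \varphi,\psi ::= a \mid \neg\varphi \mid \varphi\wedge\psi \mid \langle\alpha\rangle \mid \langle\alpha=\beta\rangle\qquad(a\in\mathbb A).$$ Put $\varphi\vee\psi:=\neg(\neg\varphi\wedge\neg\psi)$, $\top:=\langle\varepsilon\rangle$, $\bot:=\neg\top$ (node expression), $\bot:=[\neg\langle\varepsilon\rangle]$ (path expression), with the empty disjunction being $\bot$. A *data tree* is a rooted tree (finite or infinite) whose nodes carry labels from $\mathbb A$, together with an equivalence relation $\sim$ on its nodes. In a data tree, path expressions denote sets of pairs of nodes and node expressions denote sets of nodes: $\varepsilon$ is the identity relation, ${\downarrow}$ the child relation, $\alpha\beta$ relational composition, $\cup$ union, $[\varphi]=\{(x,x): x\in\varphi\}$, $a$ is the set of nodes labelled $a$, $\neg$ and $\wedge$ are complement and intersection,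 $\langle\alpha\rangle=\{x:\exists y\,(x,y)\in\alpha\}$, and $\langle\alpha=\beta\rangle=\{x:\exists y,z\ (x,y)\in\alpha,\ (x,z)\in\beta,\ y\sim z\}$. Write $\models P\equiv Q$ if $P$ and $Q$ have the same denotation in every data tree. Let $\mathsf{XP}^-$ be the set of all instances of the following equivalences, where $\varphi\le\psi$ abbreviates $\varphi\vee\psi\equiv\psi$: - Labels: $\top\equiv\bigvee_{a\in\mathbb A}a$; $\ \bot\equiv a\wedge b$ for $a\ne b$. - Predicates: $(\alpha[\neg\langle\beta\rangle])\beta\equiv\bot$; $\ [\top]\equiv\varepsilon$; $\ [\varphi\vee\psi]\equiv[\varphi]\cup[\psi]$. - Idempotent semirings: $(\alpha\cup\beta)\cup\gamma\equiv\alpha\cup(\beta\cup\gamma)$; $\ \alpha\cup\beta\equiv\beta\cup\alpha$; $\ \alpha\cup\alpha\equiv\alpha$; $\ \alpha(\beta\gamma)\equiv(\alpha\beta)\gamma$; $\ \varepsilon\alpha\equiv\alpha$; $\ \alpha\varepsilon\equiv\alpha$; $\ \alpha(\beta\cup\gamma)\equiv(\alpha\beta)\cup(\alpha\gamma)$; $\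 (\alpha\cup\beta)\gamma\equiv(\alpha\gamma)\cup(\beta\gamma)$; $\ \bot\cup\alpha\equiv\alpha$. - Nodes: $\varphi\equiv\neg(\neg\varphi\vee\psi)\vee\neg(\neg\varphi\vee\neg\psi)$; $\ \langle[\varphi]\rangle\equiv\varphi$; $\ \langle\alpha\cup\beta\rangle\equiv\langle\alpha\rangle\vee\langle\beta\rangle$; $\ \langle\alpha\beta\rangle\equiv\langle\alpha[\langle\beta\rangle]\rangle$. - Equality: $\langle\alpha=\beta\rangle\equiv\langle\beta=\alpha\rangle$; $\ \langle\alpha\cup\beta=\gamma\rangle\equiv\langle\alpha=\gamma\rangle\vee\langle\beta=\gamma\rangle$; $\ \varphi\wedge\langle\alpha=\beta\rangle\equiv\langle[\varphi]\alpha=\beta\rangle$; $\ \langle\alpha=\beta\rangle\le\langle\alpha\rangle$; $\ \langle\gamma[\langle\alpha=\beta\rangle]\rangle\le\langle\gamma\alpha=\gamma\beta\rangle$; $\ \langle\alpha=\alpha\rangle\equiv\langle\alpha\rangle$; $\ \langle\alpha=\varepsilon\rangle\wedge\langle\beta=\varepsilon\rangle\le\langle\alpha=\beta\rangle$; $\ \langle\alpha=\beta[\langle\varepsilon=\gamma\rangle]\rangle\le\langle\alpha=\beta\gamma\rangle$.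 Write $\mathsf{XP}^-\vdash P\equiv Q$ if $P\equiv Q$ can be derived from $\mathsf{XP}^-$ by reflexivity, symmetry, transitivity, and the replacement rule: from $P\equiv Q$ infer $R\equiv R'$ whenever $R'$ arises from $R$ by replacing some occurrences of $P$ by $Q$. Then: 1. For all node expressions $\varphi,\psi$: $\ \mathsf{XP}^-\vdash\varphi\equiv\psi$ if and only if $\models\varphi\equiv\psi$. 2. For all path expressions $\alpha,\beta$: $\ \mathsf{XP}^-\vdash\alpha\equiv\beta$ if and only if $\models\alpha\equiv\beta$. -/

import Mathlib

/-- The two sorts of the language: node expressions and path expressions. -/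
inductive Kind : Type where
  | node : Kind
  | path : Kind

/-- Expressions of the equality-only fragment of downward XPath over the set of labels `A`.
The two sorts are generated simultaneously:
`α, β ::= ε | ↓ | [φ] | αβ | α ∪ β` and `φ, ψ ::= a | ¬φ | φ ∧ ψ | ⟨α⟩ | ⟨α = β⟩`. -/
inductive Expr (A : Type*) : Kind → Type _ where
  | eps : Expr A .path
  | down : Expr A .path
  | test : Expr A .node → Expr A .path
  | seq : Expr A .path → Expr A .path → Expr A .path
  | union : Expr A .path → Expr A .path → Expr A .path
  | label : A → Expr A .node
  | neg : Expr A .node → Expr A .node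
  | and : Expr A .node → Expr A .node → Expr A .node
  | dia : Expr A .path → Expr A .node
  | eqDia : Expr A .path → Expr A .path → Expr A .node

/-- Node expressions. -/
abbrev NodeExpr (A : Type*) := Expr A Kind.node

/-- Path expressions. -/
abbrev PathExpr (A : Type*) := Expr A Kind.path

namespace Expr

/-- `φ ∨ ψ`, defined as usual from negation and conjunction. -/
def or {A : Type*} (φ ψ : NodeExpr A) : NodeExpr A := neg (and (neg φ) (neg ψ))

/-- `⊤ := ⟨ε⟩`. -/
def topNode {A : Type*} : NodeExpr A := dia eps

/-- `⊥ := ¬⊤`, as a node expression. -/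
def botNode {A : Type*} : NodeExpr A := neg topNode

/-- `⊥ := [¬⟨ε⟩]`, as a path expression. -/
def botPath {A : Type*} : PathExpr A := test (neg (dia eps))

/-- The disjunction of a list of node expressions; the empty disjunction is `⊥`. -/
def bigOr {A : Type*} : List (NodeExpr A) → NodeExpr A
  | [] => botNode
  | [φ] => φ
  | φ :: ψ :: l => or φ (bigOr (ψ :: l))

/-- `Replace P Q R R'`: the expression `R'` is obtained from `R` by replacing some (possibly none,
possibly all) occurrences of `P` by `Q`. -/
inductive Replace {A : Type*} {s : Kind} (P Q : Expr A s) :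
    {t : Kind} → Expr A t → Expr A t → Prop where
  | here : Replace P Q P Q
  | refl {t : Kind} (R : Expr A t) : Replace P Q R R
  | test {φ φ' : NodeExpr A} : Replace P Q φ φ' → Replace P Q (test φ) (test φ')
  | seq {α α' β β' : PathExpr A} :
      Replace P Q α α' → Replace P Q β β' → Replace P Q (seq α β) (seq α' β')
  | union {α α' β β' : PathExpr A} :
      Replace P Q α α' → Replace P Q β β' → Replace P Q (union α β) (union α' β')
  | neg {φ φ' : NodeExpr A} : Replace P Q φ φ' → Replace P Q (neg φ) (neg φ')
  | and {φ φ' ψ ψ' : NodeExpr A} :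
      Replace P Q φ φ' → Replace P Q ψ ψ' → Replace P Q (and φ ψ) (and φ' ψ')
  | dia {α α' : PathExpr A} : Replace P Q α α' → Replace P Q (dia α) (dia α')
  | eqDia {α α' β β' : PathExpr A} :
      Replace P Q α α' → Replace P Q β β' → Replace P Q (eqDia α β) (eqDia α' β')

end Expr

/-- `Derivable Ax P Q`: the equivalence `P ≡ Q` is derivable from the set of axioms `Ax`
(a set of node equivalences and path equivalences) by the rules of equational logic:
reflexivity, symmetry, transitivity, and replacement of equivalent subexpressions. -/
inductive Derivable {A : Type*} (Ax : {s : Kind} → Expr A s → Expr A s → Prop) :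
    {s : Kind} → Expr A s → Expr A s → Prop where
  | ax {s : Kind} {P Q : Expr A s} : Ax P Q → Derivable Ax P Q
  | refl {s : Kind} (P : Expr A s) : Derivable Ax P P
  | symm {s : Kind} {P Q : Expr A s} : Derivable Ax P Q → Derivable Ax Q P
  | trans {s : Kind} {P Q R : Expr A s} :
      Derivable Ax P Q → Derivable Ax Q R → Derivable Ax P R
  | repl {s t : Kind} {P Q : Expr A s} {R R' : Expr A t} :
      Derivable Ax P Q → Expr.Replace P Q R R' → Derivable Ax R R'

open Expr in
/-- The axiom system `XP⁻`: all instances of the axiom schemes, as a set of pairs `(P, Q)` standing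
for `P ≡ Q`. An axiom `φ ≤ ψ` stands for `φ ∨ ψ ≡ ψ`. -/
inductive XPMinus {A : Type*} [Fintype A] : {s : Kind} → Expr A s → Expr A s → Prop where
  -- axioms for labels
  | lbAx1 : XPMinus topNode (bigOr ((Finset.univ : Finset A).toList.map label))
  | lbAx2 (a b : A) : a ≠ b → XPMinus botNode (and (label a) (label b))
  -- path axiom schemes for predicates
  | prAx1 (α β : PathExpr A) : XPMinus (seq (seq α (test (neg (dia β)))) β) botPath
  | prAx2 : XPMinus (test topNode) eps
  | prAx3 (φ ψ : NodeExpr A) : XPMinus (test (or φ ψ)) (union (test φ) (test ψ))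
  -- path axiom schemes for idempotent semirings
  | isAx1 (α β γ : PathExpr A) : XPMinus (union (union α β) γ) (union α (union β γ))
  | isAx2 (α β : PathExpr A) : XPMinus (union α β) (union β α)
  | isAx3 (α : PathExpr A) : XPMinus (union α α) α
  | isAx4 (α β γ : PathExpr A) : XPMinus (seq α (seq β γ)) (seq (seq α β) γ)
  | isAx5_left (α : PathExpr A) : XPMinus (seq eps α) α
  | isAx5_right (α : PathExpr A) : XPMinus (seq α eps) α
  | isAx6_left (α β γ : PathExpr A) :
      XPMinus (seq α (union β γ)) (union (seq α β) (seq α γ))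
  | isAx6_right (α β γ : PathExpr A) :
      XPMinus (seq (union α β) γ) (union (seq α γ) (seq β γ))
  | isAx7 (α : PathExpr A) : XPMinus (union botPath α) α
  -- node axiom schemes
  | ndAx1 (φ ψ : NodeExpr A) :
      XPMinus φ (or (neg (or (neg φ) ψ)) (neg (or (neg φ) (neg ψ))))
  | ndAx2 (φ : NodeExpr A) : XPMinus (dia (test φ)) φ
  | ndAx3 (α β : PathExpr A) : XPMinus (dia (union α β)) (or (dia α) (dia β))
  | ndAx4 (α β : PathExpr A) : XPMinus (dia (seq α β)) (dia (seq α (test (dia β))))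
  -- node axiom schemes for equality
  | eqAx1 (α β : PathExpr A) : XPMinus (eqDia α β) (eqDia β α)
  | eqAx2 (α β γ : PathExpr A) :
      XPMinus (eqDia (union α β) γ) (or (eqDia α γ) (eqDia β γ))
  | eqAx3 (φ : NodeExpr A) (α β : PathExpr A) :
      XPMinus (and φ (eqDia α β)) (eqDia (seq (test φ) α) β)
  | eqAx4 (α β : PathExpr A) : XPMinus (or (eqDia α β) (dia α)) (dia α)
  | eqAx5 (α β γ : PathExpr A) :
      XPMinus (or (dia (seq γ (test (eqDia α β)))) (eqDia (seq γ α) (seq γ β)))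
        (eqDia (seq γ α) (seq γ β))
  | eqAx6 (α : PathExpr A) : XPMinus (eqDia α α) (dia α)
  | eqAx7 (α β : PathExpr A) :
      XPMinus (or (and (eqDia α eps) (eqDia β eps)) (eqDia α β)) (eqDia α β)
  | eqAx8 (α β γ : PathExpr A) :
      XPMinus (or (eqDia α (seq β (test (eqDia eps γ)))) (eqDia α (seq β γ)))
        (eqDia α (seq β γ))

universe u v

/-- A data tree over the set of labels `A`: a rooted tree (finite or infinite) whose nodes carry
labels from `A`, with an equivalence relation on its nodes (having the same data value). -/
structure DataTree (A : Type u) where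
  /-- The nodes. -/
  Node : Type v
  /-- `Child x y`: `y` is a child of `x`. -/
  Child : Node → Node → Prop
  /-- The root. -/
  root : Node
  /-- The root has no parent. -/
  not_child_root : ∀ x, ¬ Child x root
  /-- Every other node has exactly one parent. -/
  existsUnique_parent : ∀ y, y ≠ root → ∃! x, Child x y
  /-- The tree is connected: every node can be reached from the root. -/
  reachable : ∀ x, Relation.ReflTransGen Child root x
  /-- The label of a node. -/
  lab : Node → A
  /-- The partition of the nodes, as an equivalence relation. -/
  data : Setoid Node

namespace DataTree

/-- The values of the semantics: a node expression denotes a set of nodes, a path expression a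
set of pairs of nodes. -/
abbrev Sem {A : Type u} (T : DataTree.{u, v} A) : Kind → Type v
  | .node => Set T.Node
  | .path => Set (T.Node × T.Node)

/-- The semantics of expressions on a data tree. -/
def eval {A : Type u} (T : DataTree.{u, v} A) : {s : Kind} → Expr A s → T.Sem s
  | _, .eps => {p : T.Node × T.Node | p.1 = p.2}
  | _, .down => {p : T.Node × T.Node | T.Child p.1 p.2}
  | _, .test φ => {p : T.Node × T.Node | p.1 = p.2 ∧ p.1 ∈ (T.eval φ : Set T.Node)}
  | _, .seq α β => {p : T.Node × T.Node | ∃ y : T.Node,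
      (p.1, y) ∈ (T.eval α : Set (T.Node × T.Node)) ∧
      (y, p.2) ∈ (T.eval β : Set (T.Node × T.Node))}
  | _, .union α β => (T.eval α : Set (T.Node × T.Node)) ∪ (T.eval β : Set (T.Node × T.Node))
  | _, .label a => {x : T.Node | T.lab x = a}
  | _, .neg φ => (T.eval φ : Set T.Node)ᶜ
  | _, .and φ ψ => (T.eval φ : Set T.Node) ∩ (T.eval ψ : Set T.Node)
  | _, .dia α => {x : T.Node | ∃ y : T.Node, (x, y) ∈ (T.eval α : Set (T.Node × T.Node))}
  | _, .eqDia α β => {x : T.Node | ∃ y z : T.Node,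
      (x, y) ∈ (T.eval α : Set (T.Node × T.Node)) ∧
      (x, z) ∈ (T.eval β : Set (T.Node × T.Node)) ∧ T.data.r y z}

end DataTree

/-- Semantic equivalence: `P` and `Q` have the same denotation on every data tree
(with nodes in the universe `Type v`). -/
def SemEquiv {A : Type u} {s : Kind} (P Q : Expr A s) : Prop :=
  ∀ T : DataTree.{u, v} A, T.eval P = T.eval Q

/-! Soundness is an induction on derivations. For completeness, node expressions modulo provability
form a Boolean algebra (`ndAx1` is Huntington's equation) and path expressions an idempotent
semiring. Ultrafilters of the Boolean algebra serve as types of nodes. A walk is a finite list of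
types; it is approximated by the paths `↓[χ₁]⋯↓[χₙ]` with `χᵢ` in its `i`-th type. A type `Γ`
requires two walks to meet (`Meets`) when it contains `⟨p = q⟩` for all their approximations `p` and
`q`. A prime ideal argument (`exists_match`) finds in any path expression outside an ideal a walk
all of whose approximations stay outside. Hence `⟨α = β⟩ ∈ Γ` exactly when some walks matching `α`
and `β` meet at `Γ` (`eqDia_mem_iff`).

The canonical tree is built freely: at each node, every pair of walks required to meet gets fresh
branches that promise to follow the two walks to a common data value. This value is new, unless one
walk is empty, when it is the value of the node itself. The crux is that no unwanted equalities
arise (`meets_of_desc`). A value originates at one node and spreads downwards only through promises,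
and `eqAx5`, `eqAx7`, `eqAx8` close `Meets` under each way in which this happens.

The truth lemma follows. An unprovable inequality of node expressions then fails at the root of a
canonical tree. For paths, if `α ≤ β` is unprovable, some walk matches `α` but has no approximation
below `β`; the tree realizes it, and since walks between two nodes of a tree are unique, `β` cannot
relate its two ends. -/

namespace DataTree

/-! ### Soundness. -/

variable {A : Type u} (T : DataTree.{u, v} A)

theorem eval_or (φ ψ : NodeExpr A) :
    T.eval (Expr.or φ ψ) = ((T.eval φ : Set T.Node) ∪ (T.eval ψ : Set T.Node) : Set T.Node) := by
  simp [Expr.or, eval, Set.compl_inter]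

theorem mem_eval_bigOr (l : List (NodeExpr A)) (x : T.Node) :
    x ∈ (T.eval (Expr.bigOr l) : Set T.Node) ↔ ∃ φ ∈ l, x ∈ (T.eval φ : Set T.Node) := by
  induction l using Expr.bigOr.induct with
  | case1 => simp [Expr.bigOr, Expr.botNode, Expr.topNode, eval]
  | case2 φ => simp [Expr.bigOr]
  | case3 φ ψ l ih =>
    rw [Expr.bigOr, eval_or, Set.mem_union, ih]
    simp

theorem eval_eq_of_replace {s t : Kind} {P Q : Expr A s} {R R' : Expr A t}
    (h : T.eval P = T.eval Q) (hR : Expr.Replace P Q R R') : T.eval R = T.eval R' := by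
  induction hR with
  | here => exact h
  | refl => rfl
  | _ => simp only [eval, *]

theorem eval_eq_of_xpMinus [Fintype A] {s : Kind} {P Q : Expr A s} (h : XPMinus P Q) :
    T.eval P = T.eval Q := by
  cases h with
  | lbAx1 =>
    ext x
    rw [mem_eval_bigOr]
    simp [Expr.topNode, eval]
  | lbAx2 a b hab =>
    ext x
    simp only [Expr.botNode, Expr.topNode, eval]
    constructor
    · intro h; exact absurd ⟨x, rfl⟩ h
    · rintro ⟨h1, h2⟩; exact absurd (h1.symm.trans h2) hab
  | prAx1 =>
    ext ⟨x, y⟩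
    simp only [Expr.botPath, eval]
    constructor
    · rintro ⟨z, ⟨z', -, (rfl : z' = z), h⟩, h'⟩; exact absurd ⟨_, h'⟩ h
    · rintro ⟨-, h⟩; exact absurd ⟨x, rfl⟩ h
  | prAx2 => ext ⟨x, y⟩; simp [Expr.topNode, eval]
  | prAx3 =>
    ext ⟨x, y⟩
    rw [eval, eval_or]
    simp only [eval, Set.mem_ofPred_eq, Set.mem_union]
    tauto
  | isAx1 => exact Set.union_assoc _ _ _
  | isAx2 => exact Set.union_comm _ _
  | isAx3 => exact Set.union_self _
  | isAx4 => ext ⟨x, y⟩; simp only [eval, Set.mem_ofPred_eq]; grind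
  | isAx5_left => ext ⟨x, y⟩; simp [eval]
  | isAx5_right => ext ⟨x, y⟩; simp [eval]
  | isAx6_left => ext ⟨x, y⟩; simp only [eval, Set.mem_ofPred_eq, Set.mem_union]; grind
  | isAx6_right => ext ⟨x, y⟩; simp only [eval, Set.mem_ofPred_eq, Set.mem_union]; grind
  | isAx7 => ext ⟨x, y⟩; simp [Expr.botPath, eval]
  | ndAx1 φ ψ =>
    ext x
    simp only [eval, eval_or, Set.mem_union, Set.mem_compl_iff]
    tauto
  | ndAx2 => ext x; simp [eval]
  | ndAx3 =>
    ext x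
    rw [eval_or]
    simp only [eval, Set.mem_ofPred_eq, Set.mem_union]
    grind
  | ndAx4 => ext x; simp only [eval, Set.mem_ofPred_eq]; grind
  | eqAx1 =>
    ext x
    simp only [eval, Set.mem_ofPred_eq]
    constructor <;> rintro ⟨y, z, hy, hz, h⟩ <;> exact ⟨z, y, hz, hy, T.data.symm h⟩
  | eqAx2 =>
    ext x
    rw [eval_or]
    simp only [eval, Set.mem_ofPred_eq, Set.mem_union]
    grind
  | eqAx3 => ext x; simp only [eval, Set.mem_ofPred_eq, Set.mem_inter_iff]; grind
  | eqAx4 =>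
    rw [eval_or]
    exact Set.union_eq_right.2 fun x ⟨y, z, hy, _⟩ => ⟨y, hy⟩
  | eqAx5 =>
    rw [eval_or]
    refine Set.union_eq_right.2 ?_
    intro x
    simp only [eval, Set.mem_ofPred_eq]
    rintro ⟨y, _, hy, rfl, z, z', hz, hz', h⟩
    exact ⟨z, z', ⟨_, hy, hz⟩, ⟨_, hy, hz'⟩, h⟩
  | eqAx6 =>
    ext x
    exact ⟨fun ⟨y, _, hy, _⟩ => ⟨y, hy⟩, fun ⟨y, hy⟩ => ⟨y, y, hy, hy, T.data.refl y⟩⟩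
  | eqAx7 =>
    rw [eval_or]
    refine Set.union_eq_right.2 ?_
    intro x
    simp only [eval, Set.mem_inter_iff, Set.mem_ofPred_eq]
    rintro ⟨⟨y, _, hy, rfl, h⟩, ⟨z, _, hz, rfl, h'⟩⟩
    exact ⟨y, z, hy, hz, T.data.trans h (T.data.symm h')⟩
  | eqAx8 =>
    rw [eval_or]
    refine Set.union_eq_right.2 ?_
    intro x
    simp only [eval, Set.mem_ofPred_eq]
    rintro ⟨y, _, hy, ⟨z, hz, rfl, _, z', rfl, hz', h⟩, h'⟩
    exact ⟨y, z', hy, ⟨_, hz, hz'⟩, T.data.trans h' h⟩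

end DataTree

theorem Derivable.semEquiv {A : Type u} [Fintype A] {s : Kind} {P Q : Expr A s}
    (h : Derivable XPMinus P Q) : SemEquiv.{u, v} P Q := by
  intro T
  induction h with
  | ax h => exact T.eval_eq_of_xpMinus h
  | refl => rfl
  | symm _ ih => exact ih.symm
  | trans _ _ ih₁ ih₂ => exact ih₁.trans ih₂
  | repl _ hR ih => exact T.eval_eq_of_replace ih hR

/-! ### Boolean algebras from Huntington's equation. -/

/-- Huntington's axioms for a Boolean algebra in terms of joins and complements, with a
distinguished least element. -/
class HuntingtonAlgebra (B : Type*) extends Max B, Compl B, Bot B where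
  sup_comm' : ∀ x y : B, x ⊔ y = y ⊔ x
  sup_assoc' : ∀ x y z : B, x ⊔ y ⊔ z = x ⊔ (y ⊔ z)
  sup_idem' : ∀ x : B, x ⊔ x = x
  bot_sup' : ∀ x : B, ⊥ ⊔ x = x
  huntington : ∀ x y : B, x = (xᶜ ⊔ y)ᶜ ⊔ (xᶜ ⊔ yᶜ)ᶜ

namespace HuntingtonAlgebra

variable {B : Type*} [HuntingtonAlgebra B]

/-- Expanding all of `x`, `xᶜ`, `y`, `yᶜ` by Huntington's equation turns both sides into the join of
the same four terms. -/
theorem sup_compl_eq (x y : B) : x ⊔ xᶜ = y ⊔ yᶜ := by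
  have hx := huntington x yᶜ
  have hx' := huntington xᶜ yᶜ
  have hy := huntington y xᶜ
  have hy' := huntington yᶜ xᶜ
  have hc := sup_comm' (B := B)
  have ha := sup_assoc' (B := B)
  grind

theorem compl_compl' (x : B) : xᶜᶜ = x := by
  have h₁ := huntington x xᶜᶜ
  have h₂ := huntington xᶜᶜ xᶜ
  rw [sup_compl_eq xᶜ x, sup_comm'] at h₁
  rw [sup_comm' xᶜᶜᶜ xᶜᶜ, sup_comm' xᶜᶜᶜ xᶜ, sup_compl_eq xᶜᶜ x] at h₂
  exact h₂.trans h₁.symm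

theorem compl_sup_compl_self (x : B) : (x ⊔ xᶜ)ᶜ = ⊥ := by
  -- Both this element and `⊥` are neutral for the join, so they coincide.
  have h (y : B) : (x ⊔ xᶜ)ᶜ ⊔ y = y := by
    have := huntington y y
    rw [sup_comm' yᶜ y, sup_idem', compl_compl', sup_compl_eq y x] at this
    exact this.symm
  rw [← bot_sup' (x ⊔ xᶜ)ᶜ, sup_comm', h]

theorem sup_compl_sup_compl (x y : B) : x ⊔ (xᶜ ⊔ yᶜ)ᶜ = x := by
  have h := huntington x y
  calc x ⊔ (xᶜ ⊔ yᶜ)ᶜ = (xᶜ ⊔ y)ᶜ ⊔ (xᶜ ⊔ yᶜ)ᶜ ⊔ (xᶜ ⊔ yᶜ)ᶜ := by rw [← h]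
    _ = x := by rw [sup_assoc', sup_idem', ← h]

/-- The lattice of a Huntington algebra. -/
abbrev toLattice' (B : Type*) [HuntingtonAlgebra B] : Lattice B :=
  letI : Min B := ⟨fun x y => (xᶜ ⊔ yᶜ)ᶜ⟩
  Lattice.mk' sup_comm' sup_assoc'
    (fun x y => congrArg _ (sup_comm' _ _))
    (fun x y z => by
      change ((xᶜ ⊔ yᶜ)ᶜᶜ ⊔ zᶜ)ᶜ = (xᶜ ⊔ (yᶜ ⊔ zᶜ)ᶜᶜ)ᶜ
      rw [compl_compl', compl_compl', sup_assoc'])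
    sup_compl_sup_compl
    (fun x y => by
      have := sup_compl_sup_compl xᶜ yᶜ
      change (xᶜ ⊔ (x ⊔ y)ᶜ)ᶜ = x
      rw [compl_compl', compl_compl'] at this
      rw [this, compl_compl'])

/-- A Huntington algebra is a Boolean algebra. -/
abbrev toBooleanAlgebra (B : Type*) [HuntingtonAlgebra B] : BooleanAlgebra B :=
  letI : Lattice B := toLattice' B
  have inf_def (x y : B) : x ⊓ y = (xᶜ ⊔ yᶜ)ᶜ := rfl
  have split (x y : B) : x ⊓ yᶜ ⊔ x ⊓ y = x := by
    rw [inf_def, inf_def, compl_compl']; exact (huntington x y).symm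
  have inf_compl (x : B) : x ⊓ xᶜ = ⊥ := by
    rw [inf_def, sup_compl_eq xᶜ x, compl_sup_compl_self]
  have bot_le' (x : B) : ⊥ ≤ x := sup_eq_right.1 (bot_sup' x)
  have le_compl (x : B) : x ≤ ⊥ᶜ := by
    rw [← compl_sup_compl_self x, compl_compl']; exact le_sup_left
  letI : DistribLattice B := DistribLattice.ofInfSupLe fun x y z => by
    -- Distributivity by cases on `y`: outside `y`, split again along `z`; the part outside both
    -- lies below `(y ⊔ z) ⊓ (y ⊔ z)ᶜ = ⊥`.
    have h₁ : x ⊓ (y ⊔ z) ⊓ yᶜ ≤ x ⊓ z := by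
      rw [← split (x ⊓ (y ⊔ z) ⊓ yᶜ) z]
      refine sup_le ?_ (le_inf (inf_le_left.trans (inf_le_left.trans inf_le_left)) inf_le_right)
      have : x ⊓ (y ⊔ z) ⊓ yᶜ ⊓ zᶜ ≤ (y ⊔ z) ⊓ (y ⊔ z)ᶜ := by
        refine le_inf (inf_le_left.trans (inf_le_left.trans inf_le_right)) ?_
        have h : (y ⊔ z)ᶜ = yᶜ ⊓ zᶜ := by rw [inf_def, compl_compl', compl_compl']
        rw [h]
        exact inf_le_inf_right _ inf_le_right
      rw [inf_compl] at this
      exact this.trans (bot_le' _)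
    rw [← split (x ⊓ (y ⊔ z)) y]
    exact sup_le (h₁.trans le_sup_right)
      ((inf_le_inf_right _ inf_le_left).trans le_sup_left)
  { (inferInstance : DistribLattice B) with
    compl := compl
    bot := ⊥
    top := ⊥ᶜ
    inf_compl_le_bot := fun x => (inf_compl x).le
    top_le_sup_compl := fun x => by
      rw [← compl_sup_compl_self x, compl_compl']
    le_top := le_compl
    bot_le := bot_le' }

end HuntingtonAlgebra

/-! ### The Lindenbaum algebras of node and path expressions. -/

/-- Provable equivalence as a setoid. -/
def Derivable.setoid (A : Type u) [Fintype A] (s : Kind) : Setoid (Expr A s) where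
  r P Q := Derivable XPMinus P Q
  iseqv := ⟨Derivable.refl, Derivable.symm, Derivable.trans⟩

/-- The Lindenbaum algebra of expressions modulo provable equivalence. -/
def Lindenbaum (A : Type u) [Fintype A] (s : Kind) : Type u := Quotient (Derivable.setoid A s)

/-- Classes of node expressions modulo provable equivalence. -/
abbrev NodeClass (A : Type u) [Fintype A] := Lindenbaum A Kind.node

/-- Classes of path expressions modulo provable equivalence. -/
abbrev PathClass (A : Type u) [Fintype A] := Lindenbaum A Kind.path

/-- The class of an expression. -/
def Expr.toClass {A : Type u} [Fintype A] {s : Kind} (P : Expr A s) : Lindenbaum A s :=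
  Quotient.mk (Derivable.setoid A s) P

namespace Lindenbaum

open Expr

variable {A : Type u} [Fintype A]

theorem toClass_eq {s : Kind} {P Q : Expr A s} :
    P.toClass = Q.toClass ↔ Derivable XPMinus P Q :=
  Quotient.eq (r := Derivable.setoid A s)

theorem eq_of_xpMinus {s : Kind} {P Q : Expr A s} (h : XPMinus P Q) : P.toClass = Q.toClass :=
  toClass_eq.2 (.ax h)

theorem toClass_surjective {s : Kind} : Function.Surjective (toClass : Expr A s → _) :=
  Quotient.mk_surjective

/-- The test `[φ]` of a class of node expressions. -/
def test : NodeClass A → PathClass A :=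
  Quotient.map Expr.test fun _ _ h => .repl h (.test .here)

/-- The domain `⟨α⟩` of a class of path expressions. -/
def dia : PathClass A → NodeClass A :=
  Quotient.map Expr.dia fun _ _ h => .repl h (.dia .here)

/-- The equality test `⟨α = β⟩` of classes of path expressions. -/
def eqDia : PathClass A → PathClass A → NodeClass A :=
  Quotient.map₂ Expr.eqDia fun _ _ h _ _ h' =>
    .trans (.repl h (.eqDia .here (.refl _))) (.repl h' (.eqDia (.refl _) .here))

/-- The class of the child axis. -/
def down : PathClass A := toClass Expr.down

instance : Add (PathClass A) := ⟨Quotient.map₂ Expr.union fun _ _ h _ _ h' =>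
    .trans (.repl h (.union .here (.refl _))) (.repl h' (.union (.refl _) .here))⟩

instance : Mul (PathClass A) := ⟨Quotient.map₂ Expr.seq fun _ _ h _ _ h' =>
    .trans (.repl h (.seq .here (.refl _))) (.repl h' (.seq (.refl _) .here))⟩

instance : Zero (PathClass A) := ⟨toClass botPath⟩

instance : One (PathClass A) := ⟨toClass eps⟩

theorem derivable_or {φ φ' ψ ψ' : NodeExpr A} (h : Derivable XPMinus φ φ')
    (h' : Derivable XPMinus ψ ψ') : Derivable XPMinus (or φ ψ) (or φ' ψ') :=
  .trans (.repl h (.neg (.and (.neg .here) (.refl _))))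
    (.repl h' (.neg (.and (.refl _) (.neg .here))))

theorem dia_toClass (α : PathExpr A) : dia α.toClass = (Expr.dia α).toClass := rfl
theorem eqDia_toClass (α β : PathExpr A) :
    eqDia α.toClass β.toClass = (Expr.eqDia α β).toClass := rfl
theorem toClass_union (α β : PathExpr A) :
    (Expr.union α β).toClass = α.toClass + β.toClass := rfl

/-- The class of a join of node expressions. -/
def sup : NodeClass A → NodeClass A → NodeClass A :=
  Quotient.map₂ Expr.or fun _ _ h _ _ h' => derivable_or h h'

theorem dia_test (a : NodeClass A) : dia (test a) = a := by
  obtain ⟨φ, rfl⟩ := toClass_surjective a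
  exact eq_of_xpMinus (.ndAx2 φ)

theorem test_sup (a b : NodeClass A) : test (sup a b) = test a + test b := by
  obtain ⟨φ, rfl⟩ := toClass_surjective a
  obtain ⟨ψ, rfl⟩ := toClass_surjective b
  exact eq_of_xpMinus (.prAx3 φ ψ)

theorem test_injective : Function.Injective (test : NodeClass A → _) :=
  Function.LeftInverse.injective dia_test

theorem path_add_comm (x y : PathClass A) : x + y = y + x := by
  obtain ⟨α, rfl⟩ := toClass_surjective x
  obtain ⟨β, rfl⟩ := toClass_surjective y
  exact eq_of_xpMinus (.isAx2 α β)

theorem path_add_assoc (x y z : PathClass A) : x + y + z = x + (y + z) := by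
  obtain ⟨α, rfl⟩ := toClass_surjective x
  obtain ⟨β, rfl⟩ := toClass_surjective y
  obtain ⟨γ, rfl⟩ := toClass_surjective z
  exact eq_of_xpMinus (.isAx1 α β γ)

theorem path_add_self (x : PathClass A) : x + x = x := by
  obtain ⟨α, rfl⟩ := toClass_surjective x
  exact eq_of_xpMinus (.isAx3 α)

theorem path_zero_add (x : PathClass A) : 0 + x = x := by
  obtain ⟨α, rfl⟩ := toClass_surjective x
  exact eq_of_xpMinus (.isAx7 α)

/-- The axioms state the semilattice laws only for unions of paths; they pass to joins of nodes
because `test` is injective and turns joins into unions. -/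
instance : HuntingtonAlgebra (NodeClass A) where
  max := sup
  compl := Quotient.map Expr.neg fun _ _ h => .repl h (.neg .here)
  bot := toClass botNode
  sup_comm' x y := test_injective <| by
    simp only [test_sup, path_add_comm]
  sup_assoc' x y z := test_injective <| by
    simp only [test_sup, path_add_assoc]
  sup_idem' x := test_injective <| by
    simp only [test_sup, path_add_self]
  bot_sup' x := test_injective <| by
    rw [test_sup]
    exact path_zero_add (test x)
  huntington x y := by
    obtain ⟨φ, rfl⟩ := toClass_surjective x
    obtain ⟨ψ, rfl⟩ := toClass_surjective y
    exact eq_of_xpMinus (.ndAx1 φ ψ)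

instance : BooleanAlgebra (NodeClass A) := HuntingtonAlgebra.toBooleanAlgebra _

theorem toClass_or (φ ψ : NodeExpr A) : (or φ ψ).toClass = φ.toClass ⊔ ψ.toClass := rfl
theorem toClass_neg (φ : NodeExpr A) : (neg φ).toClass = φ.toClassᶜ := rfl
theorem toClass_botNode : (botNode : NodeExpr A).toClass = ⊥ := rfl
theorem toClass_topNode : (topNode : NodeExpr A).toClass = ⊤ := by
  rw [← compl_bot, ← toClass_botNode, botNode, toClass_neg, compl_compl]

/-- Conjunction is primitive, whereas the meet comes from the join. The two differ by double
negations, which replacement removes. -/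
theorem toClass_and (φ ψ : NodeExpr A) : (and φ ψ).toClass = φ.toClass ⊓ ψ.toClass := by
  have h : φ.toClassᶜᶜ ⊓ ψ.toClassᶜᶜ = φ.toClass ⊓ ψ.toClass := by simp only [compl_compl]
  rw [← h, ← compl_sup, ← toClass_neg, ← toClass_neg, ← toClass_or, ← toClass_neg, Expr.or,
    toClass_neg, toClass_neg, compl_compl]
  apply toClass_eq.2
  have h₁ : Derivable XPMinus φ (neg (neg φ)) := toClass_eq.1 (by simp [toClass_neg])
  have h₂ : Derivable XPMinus ψ (neg (neg ψ)) := toClass_eq.1 (by simp [toClass_neg])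
  exact .trans (.repl h₁ (.and .here (.refl _))) (.repl h₂ (.and (.refl _) .here))

theorem test_bot : test (⊥ : NodeClass A) = 0 := rfl

theorem test_top : test (⊤ : NodeClass A) = 1 := by
  rw [← toClass_topNode]; exact eq_of_xpMinus .prAx2

theorem mul_test_compl_mul (x y : PathClass A) : x * test (dia y)ᶜ * y = 0 := by
  obtain ⟨α, rfl⟩ := toClass_surjective x
  obtain ⟨β, rfl⟩ := toClass_surjective y
  exact eq_of_xpMinus (.prAx1 α β)

theorem path_one_mul (x : PathClass A) : 1 * x = x := by
  obtain ⟨α, rfl⟩ := toClass_surjective x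
  exact eq_of_xpMinus (.isAx5_left α)

theorem path_mul_one (x : PathClass A) : x * 1 = x := by
  obtain ⟨α, rfl⟩ := toClass_surjective x
  exact eq_of_xpMinus (.isAx5_right α)

theorem path_mul_add (x y z : PathClass A) : x * (y + z) = x * y + x * z := by
  obtain ⟨α, rfl⟩ := toClass_surjective x
  obtain ⟨β, rfl⟩ := toClass_surjective y
  obtain ⟨γ, rfl⟩ := toClass_surjective z
  exact eq_of_xpMinus (.isAx6_left α β γ)

theorem path_add_mul (x y z : PathClass A) : (x + y) * z = x * z + y * z := by
  obtain ⟨α, rfl⟩ := toClass_surjective x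
  obtain ⟨β, rfl⟩ := toClass_surjective y
  obtain ⟨γ, rfl⟩ := toClass_surjective z
  exact eq_of_xpMinus (.isAx6_right α β γ)

theorem path_mul_assoc (x y z : PathClass A) : x * y * z = x * (y * z) := by
  obtain ⟨α, rfl⟩ := toClass_surjective x
  obtain ⟨β, rfl⟩ := toClass_surjective y
  obtain ⟨γ, rfl⟩ := toClass_surjective z
  exact (eq_of_xpMinus (.isAx4 α β γ)).symm

theorem dia_one : dia (1 : PathClass A) = ⊤ := toClass_topNode

theorem path_mul_zero (x : PathClass A) : x * 0 = 0 := by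
  have h := mul_test_compl_mul x 1
  rwa [dia_one, compl_top, test_bot, path_mul_one] at h

theorem path_zero_mul (x : PathClass A) : 0 * x = 0 := by
  have h := mul_test_compl_mul 1 x
  -- Adding `0` to a test whose product with `x` vanishes isolates `0 * x` after distribution.
  have h' : (test (dia x)ᶜ + 0) * x = test (dia x)ᶜ * x := by
    rw [path_add_comm, path_zero_add]
  rw [path_one_mul] at h
  rwa [path_add_mul, h, path_zero_add] at h'

noncomputable instance : IdemSemiring (PathClass A) :=
  letI : Semiring (PathClass A) :=
    { add_assoc := path_add_assoc
      zero_add := path_zero_add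
      add_zero := fun x => (path_add_comm _ _).trans (path_zero_add x)
      add_comm := path_add_comm
      nsmul := nsmulRec
      left_distrib := path_mul_add
      right_distrib := path_add_mul
      zero_mul := path_zero_mul
      mul_zero := path_mul_zero
      mul_assoc := path_mul_assoc
      one_mul := path_one_mul
      mul_one := path_mul_one }
  IdemSemiring.ofSemiring path_add_self

theorem test_add (a b : NodeClass A) : test (a ⊔ b) = test a + test b := test_sup a b

theorem test_mono {a b : NodeClass A} (h : a ≤ b) : test a ≤ test b := by
  rw [← sup_eq_right.2 h, test_add, add_eq_sup]; exact le_sup_left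

theorem test_le_one (a : NodeClass A) : test a ≤ 1 := by
  rw [← test_top]; exact test_mono le_top

theorem test_compl_mul_test (a : NodeClass A) : test aᶜ * test a = 0 := by
  have h := mul_test_compl_mul 1 (test a)
  rwa [one_mul, dia_test] at h

theorem test_mul_test_compl (a : NodeClass A) : test a * test aᶜ = 0 := by
  have h := test_compl_mul_test aᶜ
  rwa [compl_compl] at h

theorem test_mul_self (a : NodeClass A) : test a * test a = test a := by
  conv_rhs => rw [← mul_one (test a), ← test_top, ← sup_compl_eq_top (x := a), test_add, mul_add,
    test_mul_test_compl, add_zero]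

theorem mul_test_le (x : PathClass A) (a : NodeClass A) : x * test a ≤ x := by
  simpa using mul_le_mul_right (test_le_one a) x

theorem test_mul_le (a : NodeClass A) (x : PathClass A) : test a * x ≤ x := by
  simpa using mul_le_mul_left (test_le_one a) x

/-- For `≥`, split `b` along `a`: the part of `b` outside `a` is killed by `test a`. -/
theorem test_inf (a b : NodeClass A) : test (a ⊓ b) = test a * test b := by
  apply le_antisymm
  · rw [← test_mul_self]
    exact mul_le_mul' (test_mono inf_le_left) (test_mono inf_le_right)
  · have hb : b = (a ⊓ b) ⊔ (aᶜ ⊓ b) := by rw [← inf_sup_right, sup_compl_eq_top, top_inf_eq]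
    have h0 : test a * test (aᶜ ⊓ b) ≤ 0 := by
      rw [← test_mul_test_compl a]
      exact mul_le_mul' le_rfl (test_mono inf_le_left)
    calc test a * test b = test a * test (a ⊓ b) + test a * test (aᶜ ⊓ b) := by
          rw [← mul_add, ← test_add, ← hb]
      _ ≤ test (a ⊓ b) + 0 := add_le_add (test_mul_le _ _) h0
      _ = _ := add_zero _

theorem dia_add (x y : PathClass A) : dia (x + y) = dia x ⊔ dia y := by
  obtain ⟨α, rfl⟩ := toClass_surjective x
  obtain ⟨β, rfl⟩ := toClass_surjective y
  exact eq_of_xpMinus (.ndAx3 α β)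

theorem dia_mul (x y : PathClass A) : dia (x * y) = dia (x * test (dia y)) := by
  obtain ⟨α, rfl⟩ := toClass_surjective x
  obtain ⟨β, rfl⟩ := toClass_surjective y
  exact eq_of_xpMinus (.ndAx4 α β)

theorem dia_mono {x y : PathClass A} (h : x ≤ y) : dia x ≤ dia y := by
  rw [← sup_eq_right.2 h, ← add_eq_sup, dia_add]; exact le_sup_left

theorem dia_zero : dia (0 : PathClass A) = ⊥ := by rw [← test_bot, dia_test]

theorem dia_mul_le (x y : PathClass A) : dia (x * y) ≤ dia x := by
  rw [dia_mul]; exact dia_mono (mul_test_le _ _)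

theorem eqDia_comm (x y : PathClass A) : eqDia x y = eqDia y x := by
  obtain ⟨α, rfl⟩ := toClass_surjective x
  obtain ⟨β, rfl⟩ := toClass_surjective y
  exact eq_of_xpMinus (.eqAx1 α β)

theorem eqDia_add_left (x y z : PathClass A) : eqDia (x + y) z = eqDia x z ⊔ eqDia y z := by
  obtain ⟨α, rfl⟩ := toClass_surjective x
  obtain ⟨β, rfl⟩ := toClass_surjective y
  obtain ⟨γ, rfl⟩ := toClass_surjective z
  exact eq_of_xpMinus (.eqAx2 α β γ)

theorem inf_eqDia (a : NodeClass A) (x y : PathClass A) :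
    a ⊓ eqDia x y = eqDia (test a * x) y := by
  obtain ⟨φ, rfl⟩ := toClass_surjective a
  obtain ⟨α, rfl⟩ := toClass_surjective x
  obtain ⟨β, rfl⟩ := toClass_surjective y
  rw [eqDia_toClass, ← toClass_and]
  exact eq_of_xpMinus (.eqAx3 φ α β)

theorem inf_eqDia_right (a : NodeClass A) (x y : PathClass A) :
    a ⊓ eqDia x y = eqDia x (test a * y) := by
  rw [eqDia_comm, inf_eqDia, eqDia_comm]

theorem eqDia_le_dia (x y : PathClass A) : eqDia x y ≤ dia x := by
  obtain ⟨α, rfl⟩ := toClass_surjective x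
  obtain ⟨β, rfl⟩ := toClass_surjective y
  exact sup_eq_right.1 (eq_of_xpMinus (.eqAx4 α β))

theorem dia_mul_test_eqDia_le (z x y : PathClass A) :
    dia (z * test (eqDia x y)) ≤ eqDia (z * x) (z * y) := by
  obtain ⟨α, rfl⟩ := toClass_surjective x
  obtain ⟨β, rfl⟩ := toClass_surjective y
  obtain ⟨γ, rfl⟩ := toClass_surjective z
  exact sup_eq_right.1 (eq_of_xpMinus (.eqAx5 α β γ))

theorem eqDia_self (x : PathClass A) : eqDia x x = dia x := by
  obtain ⟨α, rfl⟩ := toClass_surjective x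
  exact eq_of_xpMinus (.eqAx6 α)

theorem eqDia_one_inf_le (x y : PathClass A) : eqDia x 1 ⊓ eqDia y 1 ≤ eqDia x y := by
  obtain ⟨α, rfl⟩ := toClass_surjective x
  obtain ⟨β, rfl⟩ := toClass_surjective y
  refine sup_eq_right.1 ?_
  have h := eq_of_xpMinus (.eqAx7 α β)
  rwa [toClass_or, toClass_and] at h

theorem eqDia_mul_test_le (x y z : PathClass A) :
    eqDia x (y * test (eqDia 1 z)) ≤ eqDia x (y * z) := by
  obtain ⟨α, rfl⟩ := toClass_surjective x
  obtain ⟨β, rfl⟩ := toClass_surjective y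
  obtain ⟨γ, rfl⟩ := toClass_surjective z
  exact sup_eq_right.1 (eq_of_xpMinus (.eqAx8 α β γ))

theorem eqDia_mono {x x' y y' : PathClass A} (hx : x ≤ x') (hy : y ≤ y') :
    eqDia x y ≤ eqDia x' y' := by
  have h {x x' y : PathClass A} (hx : x ≤ x') : eqDia x y ≤ eqDia x' y := by
    rw [← sup_eq_right.2 hx, ← add_eq_sup, eqDia_add_left]; exact le_sup_left
  refine (h hx).trans ?_
  rw [eqDia_comm, eqDia_comm x']
  exact h hy

theorem eqDia_zero_left (x : PathClass A) : eqDia 0 x = ⊥ :=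
  le_bot_iff.1 <| (eqDia_le_dia _ _).trans_eq dia_zero

end Lindenbaum

/-! ### Ultrafilters as points, in an arbitrary universe. -/

namespace Expr

/-- Renaming of labels. -/
def rename {A : Type*} {B : Type*} (f : A → B) : {s : Kind} → Expr A s → Expr B s
  | _, .eps => .eps
  | _, .down => .down
  | _, .test φ => .test (φ.rename f)
  | _, .seq α β => .seq (α.rename f) (β.rename f)
  | _, .union α β => .union (α.rename f) (β.rename f)
  | _, .label a => .label (f a)
  | _, .neg φ => .neg (φ.rename f)
  | _, .and φ ψ => .and (φ.rename f) (ψ.rename f)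
  | _, .dia α => .dia (α.rename f)
  | _, .eqDia α β => .eqDia (α.rename f) (β.rename f)

theorem rename_injective {A : Type*} {B : Type*} {f : A → B} (hf : Function.Injective f)
    {s : Kind} : Function.Injective (rename f : Expr A s → Expr B s) := by
  intro P
  induction P <;> intro Q h <;> cases Q <;> simp_all [rename] <;> grind [Function.Injective]

/-- Semantic equivalence quantifies over trees in `Type v`, so the types of nodes must be moved
there from the universe of the labels. -/
instance {A : Type u} [Small.{v} A] {s : Kind} : Small.{v} (Expr A s) :=
  let f := rename (s := s) (equivShrink.{v} A)
  have hf : Function.Injective f := rename_injective (equivShrink.{v} A).injective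
  small_of_injective hf

end Expr

/-- Ultrafilters of a Boolean algebra. -/
structure BoolUltrafilter (B : Type*) [BooleanAlgebra B] where
  /-- The underlying set. -/
  carrier : Set B
  inf_mem' : ∀ {a b}, a ∈ carrier → b ∈ carrier → a ⊓ b ∈ carrier
  mem_of_le' : ∀ {a b}, a ≤ b → a ∈ carrier → b ∈ carrier
  compl_mem_iff' : ∀ {a}, aᶜ ∈ carrier ↔ a ∉ carrier

namespace BoolUltrafilter

variable {B : Type*} [BooleanAlgebra B]

theorem carrier_injective : Function.Injective (carrier : BoolUltrafilter B → Set B) := by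
  rintro ⟨S, _⟩ ⟨T, _⟩ rfl; rfl

/-- Prime ideal theorem: the complement of a prime ideal containing `I` but not `c` is the
ultrafilter. -/
theorem exists_of_ideal (I : B → Prop) (bot : I ⊥) (sup : ∀ {a b}, I a → I b → I (a ⊔ b))
    (mono : ∀ {a b}, a ≤ b → I b → I a) {c : B} (hc : ¬ I c) :
    ∃ U : BoolUltrafilter B, c ∈ U.carrier ∧ ∀ a ∈ U.carrier, ¬ I a := by
  let J : Order.Ideal B :=
    { carrier := {a | I a}
      lower' := fun a b h ha => mono h ha
      nonempty' := ⟨⊥, bot⟩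
      directed' := fun a ha b hb => ⟨a ⊔ b, sup ha hb, le_sup_left, le_sup_right⟩ }
  have hd : Disjoint (Order.PFilter.principal c : Set B) (J : Set B) := by
    rw [Set.disjoint_left]
    intro a ha hJ
    exact hc (mono (Order.PFilter.mem_principal.1 ha) hJ)
  obtain ⟨K, hK, hJK, hcK⟩ := DistribLattice.prime_ideal_of_disjoint_filter_ideal hd
  have hcompl {a : B} : aᶜ ∉ K ↔ a ∈ K := by
    constructor
    · exact fun h => (hK.mem_or_compl_mem).resolve_right h
    · exact fun h h' => hK.toIsProper.notMem_of_compl_mem h' h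
  refine ⟨⟨{a | a ∉ K}, ?_, ?_, ?_⟩, ?_, ?_⟩
  · intro a b ha hb hab
    exact (hK.mem_or_mem hab).elim ha hb
  · exact fun h ha hb => ha (K.lower h hb)
  · intro a
    simp only [Set.mem_ofPred_eq, hcompl, not_not]
  · exact Set.disjoint_left.1 hcK (Order.PFilter.mem_principal.2 le_rfl)
  · exact fun a ha h => ha (hJK h)

end BoolUltrafilter

instance {A : Type u} [Fintype A] : Small.{v} (BoolUltrafilter (NodeClass A)) :=
  have : Small.{v} (NodeClass A) := small_of_surjective Lindenbaum.toClass_surjective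
  small_of_injective BoolUltrafilter.carrier_injective

open Lindenbaum

/-- The points of the dual space of the Lindenbaum algebra of node expressions, in an arbitrary
universe: complete consistent types of nodes. -/
def Point (A : Type u) [Fintype A] : Type v := Shrink.{v} (BoolUltrafilter (NodeClass A))

namespace Point

variable {A : Type u} [Fintype A]

/-- The ultrafilter of a point. -/
noncomputable def toUltrafilter (Γ : Point.{u, v} A) : BoolUltrafilter (NodeClass A) :=
  (equivShrink.{v} (BoolUltrafilter (NodeClass A))).symm Γ

noncomputable instance : Membership (NodeClass A) (Point.{u, v} A) :=
  ⟨fun Γ a => a ∈ Γ.toUltrafilter.carrier⟩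

variable {Γ Δ : Point.{u, v} A} {a b : NodeClass A}

theorem mem_of_le (h : a ≤ b) (ha : a ∈ Γ) : b ∈ Γ := Γ.toUltrafilter.mem_of_le' h ha

theorem compl_mem_iff : aᶜ ∈ Γ ↔ a ∉ Γ := Γ.toUltrafilter.compl_mem_iff'

theorem inf_mem_iff : a ⊓ b ∈ Γ ↔ a ∈ Γ ∧ b ∈ Γ :=
  ⟨fun h => ⟨mem_of_le inf_le_left h, mem_of_le inf_le_right h⟩,
    fun h => Γ.toUltrafilter.inf_mem' h.1 h.2⟩

theorem top_mem : ⊤ ∈ Γ := by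
  by_contra h
  exact h (mem_of_le le_top (compl_mem_iff.2 h))

theorem bot_notMem : ⊥ ∉ Γ := by
  rw [← compl_mem_iff, compl_bot]; exact top_mem

theorem sup_mem_iff : a ⊔ b ∈ Γ ↔ a ∈ Γ ∨ b ∈ Γ := by
  rw [← not_iff_not, ← compl_mem_iff, compl_sup, inf_mem_iff, compl_mem_iff, compl_mem_iff,
    not_or]

theorem ext_of_subset (h : ∀ a ∈ Γ, a ∈ Δ) : Γ = Δ := by
  apply (equivShrink.{v} (BoolUltrafilter (NodeClass A))).symm.injective
  apply BoolUltrafilter.carrier_injective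
  refine Set.Subset.antisymm h fun a ha => ?_
  by_contra h'
  exact compl_mem_iff.1 (h _ (compl_mem_iff.2 h')) ha

theorem exists_of_ideal (I : NodeClass A → Prop) (bot : I ⊥)
    (sup : ∀ {a b}, I a → I b → I (a ⊔ b)) (mono : ∀ {a b}, a ≤ b → I b → I a)
    {c : NodeClass A} (hc : ¬ I c) : ∃ Γ : Point.{u, v} A, c ∈ Γ ∧ ∀ a ∈ Γ, ¬ I a := by
  obtain ⟨U, hU⟩ := BoolUltrafilter.exists_of_ideal I bot sup mono hc
  refine ⟨equivShrink.{v} (BoolUltrafilter (NodeClass A)) U, ?_⟩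
  have : toUltrafilter (A := A) (equivShrink.{v} _ U) = U := Equiv.symm_apply_apply _ U
  change c ∈ (toUltrafilter _).carrier ∧ ∀ a ∈ (toUltrafilter _).carrier, ¬ I a
  rwa [this]

theorem exists_label_mem (Γ : Point.{u, v} A) : ∃ a : A, (Expr.label a).toClass ∈ Γ := by
  have h (l : List A) (hl : (Expr.bigOr (l.map Expr.label)).toClass ∈ Γ) :
      ∃ a : A, (Expr.label a).toClass ∈ Γ := by
    induction l with
    | nil => exact absurd hl bot_notMem
    | cons a l ih =>
      cases l with
      | nil => exact ⟨a, hl⟩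
      | cons b l =>
        simp only [List.map_cons, Expr.bigOr, toClass_or, sup_mem_iff] at hl ih
        exact hl.elim (fun h => ⟨a, h⟩) ih
  apply h (Finset.univ : Finset A).toList
  rw [← eq_of_xpMinus .lbAx1, toClass_topNode]
  exact top_mem

theorem label_unique {x y : A} (hx : (Expr.label x).toClass ∈ Γ)
    (hy : (Expr.label y).toClass ∈ Γ) : x = y := by
  by_contra h
  have := eq_of_xpMinus (.lbAx2 x y h)
  apply bot_notMem (Γ := Γ)
  rw [← toClass_botNode, this, toClass_and, inf_mem_iff]
  exact ⟨hx, hy⟩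

/-- The label of a point. -/
noncomputable def lab (Γ : Point.{u, v} A) : A := Γ.exists_label_mem.choose

theorem lab_eq_iff {x : A} : Γ.lab = x ↔ (Expr.label x).toClass ∈ Γ := by
  have h := Γ.exists_label_mem.choose_spec
  exact ⟨fun h' => h' ▸ h, label_unique h⟩

/-- The last point of a walk that starts at `Γ` and goes through the points `w`. -/
def endpoint (Γ : Point.{u, v} A) : List (Point.{u, v} A) → Point.{u, v} A
  | [] => Γ
  | Δ :: w => Δ.endpoint w

end Point

/-! ### Walks, their approximations, and walks required to meet. -/

namespace Lindenbaum

variable {A : Type u} [Fintype A]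

/-- The path `↓[χ₁]↓[χ₂]⋯↓[χₙ]`. -/
def walk : List (NodeClass A) → PathClass A
  | [] => 1
  | a :: l => down * (test a * walk l)

theorem walk_append (l m : List (NodeClass A)) : walk (l ++ m) = walk l * walk m := by
  induction l with
  | nil => exact (one_mul _).symm
  | cons a l ih => simp only [List.cons_append, walk, ih, mul_assoc]

/-- `χs` is a list of members of the points in `w`. -/
abbrev Approx (χs : List (NodeClass A)) (w : List (Point.{u, v} A)) : Prop :=
  List.Forall₂ (fun a Γ => a ∈ Γ) χs w

theorem exists_approx (w : List (Point.{u, v} A)) : ∃ χs, Approx χs w := by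
  induction w with
  | nil => exact ⟨_, .nil⟩
  | cons Δ w ih => obtain ⟨χs, h⟩ := ih; exact ⟨⊤ :: χs, .cons Point.top_mem h⟩

/-- Approximations of a walk are directed downwards, which is what makes the families defined
through them ideals. -/
theorem Approx.inf {χs ηs : List (NodeClass A)} {w : List (Point.{u, v} A)} (h : Approx χs w)
    (h' : Approx ηs w) : ∃ θs, Approx θs w ∧ walk θs ≤ walk χs ∧ walk θs ≤ walk ηs := by
  induction h generalizing ηs with
  | nil => cases h'; exact ⟨[], .nil, le_rfl, le_rfl⟩
  | cons ha _ ih =>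
    cases h' with
    | cons hb h' =>
      obtain ⟨θs, h, h₁, h₂⟩ := ih h'
      exact ⟨_ :: θs, .cons (Point.inf_mem_iff.2 ⟨ha, hb⟩) h,
        mul_le_mul' le_rfl (mul_le_mul' (test_mono inf_le_left) h₁),
        mul_le_mul' le_rfl (mul_le_mul' (test_mono inf_le_right) h₂)⟩

theorem Approx.append_inv {θs : List (NodeClass A)} {w v : List (Point.{u, v} A)}
    (h : Approx θs (w ++ v)) : ∃ χs ηs, θs = χs ++ ηs ∧ Approx χs w ∧ Approx ηs v :=
  ⟨_, _, (List.take_append_drop _ _).symm, List.forall₂_take_append _ _ _ h,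
    List.forall₂_drop_append _ _ _ h⟩

theorem Approx.append {χs ηs : List (NodeClass A)} {w v : List (Point.{u, v} A)}
    (h : Approx χs w) (h' : Approx ηs v) : Approx (χs ++ ηs) (w ++ v) :=
  List.rel_append h h'

/-- A member of the endpoint of a walk can be absorbed into an approximation of the walk. -/
theorem Approx.absorb {Γ : Point.{u, v} A} {w : List (Point.{u, v} A)} {a b : NodeClass A}
    {χs : List (NodeClass A)} (ha : a ∈ Γ) (h : Approx χs w) (hb : b ∈ Γ.endpoint w) :
    ∃ a' ∈ Γ, ∃ χs', Approx χs' w ∧ test a' * walk χs' ≤ test a * walk χs * test b := by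
  induction h generalizing Γ a with
  | nil =>
    refine ⟨a ⊓ b, Point.inf_mem_iff.2 ⟨ha, hb⟩, [], .nil, ?_⟩
    simp only [walk, mul_one, test_inf, le_refl]
  | cons hc _ ih =>
    obtain ⟨c', hc', χs', h', hle⟩ := ih hc hb
    refine ⟨a, ha, c' :: χs', .cons hc' h', ?_⟩
    simp only [walk, mul_assoc] at hle ⊢
    exact mul_le_mul' le_rfl (mul_le_mul' le_rfl hle)

/-- The type `Γ` requires that walks of types `w` and `v` lead to the same data value. -/
def Meets (Γ : Point.{u, v} A) (w v : List (Point.{u, v} A)) : Prop :=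
  ∀ χs ηs, Approx χs w → Approx ηs v → eqDia (walk χs) (walk ηs) ∈ Γ

namespace Meets

variable {Γ Δ Δ' : Point.{u, v} A} {w v : List (Point.{u, v} A)}

theorem nil_nil : Meets Γ [] [] := by
  intro χs ηs h h'
  cases h; cases h'
  rw [eqDia_self, walk, dia_one]
  exact Point.top_mem

theorem symm (h : Meets Γ w v) : Meets Γ v w := fun χs ηs h₁ h₂ => by
  rw [eqDia_comm]; exact h _ _ h₂ h₁

theorem of_dia (h : ∀ χs, Approx χs w → dia (walk χs) ∈ Γ) : Meets Γ w w := by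
  intro χs χs' h₁ h₂
  obtain ⟨θs, h₃, hle, hle'⟩ := h₁.inf h₂
  refine Point.mem_of_le (eqDia_mono hle hle') ?_
  rw [eqDia_self]
  exact h _ h₃

theorem dia_mem (h : Meets Γ w v) {χs : List (NodeClass A)} (hχ : Approx χs w) :
    dia (walk χs) ∈ Γ := by
  obtain ⟨ηs, hη⟩ := exists_approx v
  exact Point.mem_of_le (eqDia_le_dia _ _) (h _ _ hχ hη)

theorem left (h : Meets Γ w v) : Meets Γ w w := of_dia fun _ hχ => h.dia_mem hχ

theorem right (h : Meets Γ w v) : Meets Γ v v := h.symm.left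

theorem trans_nil (h : Meets Γ [] w) (h' : Meets Γ [] v) : Meets Γ w v := by
  intro χs ηs h₁ h₂
  refine Point.mem_of_le (eqDia_one_inf_le _ _) (Point.inf_mem_iff.2 ⟨?_, ?_⟩)
  · exact h.symm _ _ h₁ .nil
  · exact h'.symm _ _ h₂ .nil

/-- If `Δ` contained `¬⟨p⟩` for an approximation `p` of `w`, then `↓[¬⟨p⟩]p`, which `prAx1` makes
`0`, would approximate `Δ :: w`. -/
theorem tail (h : Meets Γ (Δ :: w) v) : Meets Δ w w := by
  refine of_dia fun χs hχ => ?_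
  by_contra hn
  have h₁ := h.dia_mem (.cons (Point.compl_mem_iff.2 hn) hχ)
  rw [walk, ← mul_assoc, mul_test_compl_mul, dia_zero] at h₁
  exact Point.bot_notMem h₁

theorem head (h : Meets Γ (Δ :: w) v) {a : NodeClass A} (ha : a ∈ Δ) :
    dia (down * test a) ∈ Γ := by
  obtain ⟨χs, hχ⟩ := exists_approx w
  have h₁ := h.dia_mem (.cons ha hχ)
  rw [walk, ← mul_assoc] at h₁
  exact Point.mem_of_le (dia_mul_le _ _) h₁

theorem cons (hΔ : ∀ a ∈ Δ, dia (down * test a) ∈ Γ) (h : Meets Δ w v) :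
    Meets Γ (Δ :: w) (Δ :: v) := by
  intro χs ηs h₁ h₂
  cases h₁ with
  | @cons a _ χs _ ha h₁ =>
  cases h₂ with
  | @cons b _ ηs _ hb h₂ =>
  refine Point.mem_of_le ?_ (hΔ _ (Point.inf_mem_iff.2 ⟨ha, Point.inf_mem_iff.2
    ⟨hb, h _ _ h₁ h₂⟩⟩))
  rw [inf_eqDia_right, inf_eqDia]
  exact dia_mul_test_eqDia_le _ _ _

end Meets

/-- The walk `w` prolongs `u` by a walk whose last node has, by necessity, the same data value as
the last node of `u`. -/
def Prolongs (Γ : Point.{u, v} A) (u w : List (Point.{u, v} A)) : Prop :=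
  ∃ δ, w = u ++ δ ∧ Meets (Γ.endpoint u) [] δ

/-- The condition `⟨ε = q⟩`, for `q` an approximation of the added walk, is absorbed as a test at
the end of `u`; `eqAx8` then replaces this test by `q` itself. -/
theorem Meets.prolong {Γ : Point.{u, v} A} {v u w : List (Point.{u, v} A)} (h : Meets Γ v u)
    (hu : Prolongs Γ u w) : Meets Γ v w := by
  obtain ⟨δ, rfl, hδ⟩ := hu
  intro ηs θs h₁ h₂
  obtain ⟨χs, ζs, rfl, hχ, hζ⟩ := h₂.append_inv
  obtain ⟨a, ha, χs', hχ', hle⟩ := hχ.absorb Point.top_mem (hδ _ _ .nil hζ)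
  rw [walk_append]
  refine Point.mem_of_le ?_ (Point.inf_mem_iff.2 ⟨ha, h _ _ h₁ hχ'⟩)
  rw [inf_eqDia_right]
  refine (eqDia_mono le_rfl hle).trans ?_
  rw [test_top, one_mul]
  exact eqDia_mul_test_le _ _ _

/-! ### Matching path expressions with walks by prime ideals. -/

/-- `Match α Γ w`: walks of type `w` from nodes of type `Γ` are in the denotation of `α`. -/
inductive Match : PathExpr A → Point.{u, v} A → List (Point.{u, v} A) → Prop
  | eps {Γ} : Match .eps Γ []
  | down {Γ} (Δ) : Match .down Γ [Δ]
  | test {Γ} {φ : NodeExpr A} : φ.toClass ∈ Γ → Match (.test φ) Γ []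
  | seq {Γ w v} {α β : PathExpr A} :
      Match α Γ w → Match β (Γ.endpoint w) v → Match (.seq α β) Γ (w ++ v)
  | union_left {Γ w} {α β : PathExpr A} : Match α Γ w → Match (.union α β) Γ w
  | union_right {Γ w} {α β : PathExpr A} : Match β Γ w → Match (.union α β) Γ w

theorem Match.exists_le {α : PathExpr A} {Γ : Point.{u, v} A} {w : List (Point.{u, v} A)}
    (h : Match α Γ w) :
    ∃ a ∈ Γ, ∃ χs, Approx χs w ∧ Lindenbaum.test a * walk χs ≤ α.toClass := by
  induction h with
  | eps => exact ⟨⊤, Point.top_mem, [], .nil, by rw [test_top, walk, mul_one]; rfl⟩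
  | down Δ =>
    refine ⟨⊤, Point.top_mem, [⊤], .cons Point.top_mem .nil, ?_⟩
    simp only [test_top, walk, mul_one, one_mul]; rfl
  | test hφ => exact ⟨_, hφ, [], .nil, by rw [walk, mul_one]; rfl⟩
  | seq _ _ ih₁ ih₂ =>
    obtain ⟨a, ha, χs, hχ, hle⟩ := ih₁
    obtain ⟨b, hb, ηs, hη, hle'⟩ := ih₂
    obtain ⟨a', ha', χs', hχ', hle''⟩ := hχ.absorb ha hb
    refine ⟨a', ha', χs' ++ ηs, hχ'.append hη, ?_⟩
    calc _ = Lindenbaum.test a' * walk χs' * walk ηs := by rw [walk_append, mul_assoc]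
      _ ≤ Lindenbaum.test a * walk χs * Lindenbaum.test b * walk ηs := mul_le_mul' hle'' le_rfl
      _ = (Lindenbaum.test a * walk χs) * (Lindenbaum.test b * walk ηs) := mul_assoc _ _ _
      _ ≤ _ := mul_le_mul' hle hle'
  | union_left _ ih =>
    obtain ⟨a, ha, χs, hχ, hle⟩ := ih
    exact ⟨a, ha, χs, hχ, hle.trans (by rw [toClass_union, add_eq_sup]; exact le_sup_left)⟩
  | union_right _ ih =>
    obtain ⟨a, ha, χs, hχ, hle⟩ := ih
    exact ⟨a, ha, χs, hχ, hle.trans (by rw [toClass_union, add_eq_sup]; exact le_sup_right)⟩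

/-- Ideals of the semilattice of classes of path expressions. -/
structure IsPathIdeal (I : PathClass A → Prop) : Prop where
  zero : I 0
  add : ∀ {x y}, I x → I y → I (x + y)
  mono : ∀ {x y}, x ≤ y → I y → I x

namespace IsPathIdeal

variable {I : PathClass A → Prop}

theorem exists_point (hI : IsPathIdeal I) (x y : PathClass A) {c : NodeClass A}
    (hc : ¬ I (x * test c * y)) :
    ∃ Γ : Point.{u, v} A, c ∈ Γ ∧ ∀ a ∈ Γ, ¬ I (x * test a * y) := by
  refine Point.exists_of_ideal (fun a => I (x * test a * y)) ?_ ?_ ?_ hc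
  · simpa [test_bot] using hI.zero
  · intro a b ha hb
    simpa only [test_add, mul_add, add_mul] using hI.add ha hb
  · intro a b h
    exact hI.mono (mul_le_mul' (mul_le_mul' le_rfl (test_mono h)) le_rfl)

theorem mul_right (hI : IsPathIdeal I) (y : PathClass A) : IsPathIdeal fun x => I (x * y) where
  zero := by simpa using hI.zero
  add h h' := by simpa only [add_mul] using hI.add h h'
  mono h := hI.mono (mul_le_mul' h le_rfl)

theorem approx_mul (hI : IsPathIdeal I) (Γ : Point.{u, v} A) (w : List (Point.{u, v} A)) :
    IsPathIdeal fun x => ∃ a ∈ Γ, ∃ χs, Approx χs w ∧ I (test a * walk χs * x) where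
  zero := by
    obtain ⟨χs, h⟩ := exists_approx w
    exact ⟨⊤, Point.top_mem, χs, h, by simpa using hI.zero⟩
  add := by
    rintro x y ⟨a, ha, χs, hχ, hx⟩ ⟨b, hb, ηs, hη, hy⟩
    obtain ⟨θs, hθ, h₁, h₂⟩ := hχ.inf hη
    refine ⟨a ⊓ b, Point.inf_mem_iff.2 ⟨ha, hb⟩, θs, hθ, ?_⟩
    rw [mul_add]
    exact hI.add
      (hI.mono (mul_le_mul' (mul_le_mul' (test_mono inf_le_left) h₁) le_rfl) hx)
      (hI.mono (mul_le_mul' (mul_le_mul' (test_mono inf_le_right) h₂) le_rfl) hy)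
  mono := by
    rintro x y h ⟨a, ha, χs, hχ, hx⟩
    exact ⟨a, ha, χs, hχ, hI.mono (mul_le_mul' le_rfl h) hx⟩

/-- A path expression outside an ideal is matched by a walk all of whose approximations are outside
that ideal. -/
theorem exists_match (hI : IsPathIdeal I) {α : PathExpr A} (hα : ¬ I α.toClass) :
    ∃ (Γ : Point.{u, v} A) (w : List (Point.{u, v} A)), Match α Γ w ∧
      ∀ a ∈ Γ, ∀ χs, Approx χs w → ¬ I (test a * walk χs) := by
  -- Induction runs over both sorts at once, with a trivial claim for nodes. The ideal is
  -- generalized because composition changes it.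
  suffices h : ∀ (s : Kind) (P : Expr A s), match s, P with
      | .node, _ => True
      | .path, α => ∀ I : PathClass A → Prop, IsPathIdeal I → ¬ I α.toClass →
        ∃ (Γ : Point.{u, v} A) (w : List (Point.{u, v} A)), Match α Γ w ∧
          ∀ a ∈ Γ, ∀ χs, Approx χs w → ¬ I (test a * walk χs) from h _ α I hI hα
  intro s P
  induction P with
  | label | neg | and | dia | eqDia => trivial
  | eps =>
    intro I hI hα
    obtain ⟨Γ, -, hΓ⟩ := hI.exists_point 1 1 (c := ⊤)
      (by simpa [test_top] using show ¬ I 1 from hα)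
    refine ⟨Γ, [], .eps, fun a ha χs hχ => ?_⟩
    cases hχ
    simpa [walk] using hΓ a ha
  | test φ =>
    intro I hI hα
    obtain ⟨Γ, h, hΓ⟩ := hI.exists_point 1 1 (c := φ.toClass)
      (by simpa using show ¬ I (Lindenbaum.test φ.toClass) from hα)
    refine ⟨Γ, [], .test h, fun a ha χs hχ => ?_⟩
    cases hχ
    simpa [walk] using hΓ a ha
  | down =>
    intro I hI hα
    obtain ⟨Γ, -, hΓ⟩ := hI.exists_point 1 down (c := ⊤)
      (by simpa [test_top] using show ¬ I down from hα)
    obtain ⟨Δ, -, hΔ⟩ := (hI.approx_mul Γ []).exists_point down 1 (c := ⊤) (by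
      rintro ⟨a, ha, χs, hχ, h⟩
      cases hχ
      exact hΓ a ha (by simpa [walk, test_top] using h))
    refine ⟨Γ, [Δ], .down Δ, fun a ha χs hχ h => ?_⟩
    cases hχ with
    | @cons b _ _ _ hb hχ =>
    cases hχ
    refine hΔ b hb ⟨a, ha, [], .nil, ?_⟩
    simpa [walk, mul_assoc] using h
  | union α β ihα ihβ =>
    intro I hI hα
    by_cases h : I α.toClass
    · obtain ⟨Γ, w, hw, hΓ⟩ := ihβ I hI fun h' => hα (hI.add h h')
      exact ⟨Γ, w, .union_right hw, hΓ⟩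
    · obtain ⟨Γ, w, hw, hΓ⟩ := ihα I hI h
      exact ⟨Γ, w, .union_left hw, hΓ⟩
  | seq α β ihα ihβ =>
    intro I hI hα
    obtain ⟨Γ, w, hw, hΓ⟩ := ihα _ (hI.mul_right β.toClass) hα
    obtain ⟨Δ, v, hv, hΔ⟩ := ihβ _ (hI.approx_mul Γ w) (by
      rintro ⟨a, ha, χs, hχ, h⟩
      exact hΓ a ha χs hχ h)
    -- The two walks fit together: if `b` held at the end of `w` and `bᶜ` at the start of `v`, some
    -- approximation would contain `[b][¬b] = 0`.
    have hend : Γ.endpoint w = Δ := by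
      refine Point.ext_of_subset fun b hb => ?_
      by_contra hb'
      obtain ⟨χs, hχ⟩ := exists_approx w
      obtain ⟨ηs, hη⟩ := exists_approx v
      obtain ⟨a, ha, χs', hχ', hle⟩ := hχ.absorb Point.top_mem hb
      refine hΔ _ (Point.compl_mem_iff.2 hb') ηs hη ⟨a, ha, χs', hχ', ?_⟩
      refine hI.mono ((mul_le_mul' hle le_rfl).trans_eq ?_) hI.zero
      rw [mul_assoc _ (test b), ← mul_assoc (test b), test_mul_test_compl, zero_mul, mul_zero]
    refine ⟨Γ, w ++ v, .seq hw (hend ▸ hv), fun a ha θs hθ h => ?_⟩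
    obtain ⟨χs, ηs, rfl, hχ, hη⟩ := hθ.append_inv
    refine hΔ ⊤ Point.top_mem ηs hη ⟨a, ha, χs, hχ, ?_⟩
    rwa [test_top, one_mul, mul_assoc, ← walk_append]

end IsPathIdeal

/-- Forwards, `exists_match` is used twice: on the ideal of `x` with `⟨x = β⟩ ∉ Γ` to replace `α` by
a walk, then on the ideal given by the approximations of that walk to replace `β`. By `eqAx3` the
tests at the start of either walk lie in `Γ`, so both walks start at `Γ`. -/
theorem eqDia_mem_iff {α β : PathExpr A} {Γ : Point.{u, v} A} :
    eqDia α.toClass β.toClass ∈ Γ ↔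
      ∃ w v, Match α Γ w ∧ Match β Γ v ∧ Meets Γ w v := by
  constructor
  · intro h
    have hI : IsPathIdeal fun x => eqDia x β.toClass ∉ Γ :=
      { zero := by rw [eqDia_zero_left]; exact Point.bot_notMem
        add := fun h h' => by rw [eqDia_add_left, Point.sup_mem_iff]; tauto
        mono := fun h h' h'' => h' (Point.mem_of_le (eqDia_mono h le_rfl) h'') }
    obtain ⟨Γ', w, hw, hΓ⟩ := hI.exists_match.{u, v} (not_not.2 h)
    simp only [not_not, ← inf_eqDia, Point.inf_mem_iff] at hΓ
    have hJ : IsPathIdeal fun x => ∃ χs, Approx χs w ∧ eqDia x (walk χs) ∉ Γ :=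
      { zero := by
          obtain ⟨χs, hχ⟩ := exists_approx w
          exact ⟨χs, hχ, by rw [eqDia_zero_left]; exact Point.bot_notMem⟩
        add := by
          rintro x y ⟨χs, hχ, hx⟩ ⟨ηs, hη, hy⟩
          obtain ⟨θs, hθ, h₁, h₂⟩ := hχ.inf hη
          refine ⟨θs, hθ, ?_⟩
          rw [eqDia_add_left, Point.sup_mem_iff, not_or]
          exact ⟨fun h => hx (Point.mem_of_le (eqDia_mono le_rfl h₁) h),
            fun h => hy (Point.mem_of_le (eqDia_mono le_rfl h₂) h)⟩
        mono := by
          rintro x y hle ⟨χs, hχ, hx⟩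
          exact ⟨χs, hχ, fun h => hx (Point.mem_of_le (eqDia_mono hle le_rfl) h)⟩ }
    obtain ⟨χ₀, hχ₀⟩ := exists_approx w
    obtain rfl : Γ' = Γ := Point.ext_of_subset fun a ha => (hΓ a ha χ₀ hχ₀).1
    obtain ⟨Δ, v, hv, hΔ⟩ := hJ.exists_match.{u, v} (α := β) (by
      rintro ⟨χs, hχ, hx⟩
      rw [eqDia_comm] at hx
      exact hx (hΓ ⊤ Point.top_mem χs hχ).2)
    replace hΔ : ∀ a ∈ Δ, ∀ ηs, Approx ηs v → ∀ χs, Approx χs w →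
        a ∈ Γ' ∧ eqDia (walk ηs) (walk χs) ∈ Γ' := by
      intro a ha ηs hη χs hχ
      rw [← Point.inf_mem_iff, inf_eqDia]
      by_contra h
      exact hΔ a ha ηs hη ⟨χs, hχ, h⟩
    obtain ⟨η₀, hη₀⟩ := exists_approx v
    obtain rfl : Δ = Γ' := Point.ext_of_subset fun a ha => (hΔ a ha η₀ hη₀ χ₀ hχ₀).1
    exact ⟨w, v, hw, hv, Meets.symm fun ηs χs hη hχ => (hΔ ⊤ Point.top_mem ηs hη χs hχ).2⟩
  · rintro ⟨w, v, hw, hv, h⟩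
    obtain ⟨a, ha, χs, hχ, hle⟩ := hw.exists_le
    obtain ⟨b, hb, ηs, hη, hle'⟩ := hv.exists_le
    refine Point.mem_of_le (eqDia_mono hle hle') ?_
    rw [← inf_eqDia, ← inf_eqDia_right]
    exact Point.inf_mem_iff.2 ⟨ha, Point.inf_mem_iff.2 ⟨hb, h _ _ hχ hη⟩⟩

end Lindenbaum

/-! ### The canonical tree: edges, promises and data values. -/

namespace CanonicalTree

variable {A : Type u} [Fintype A]

/-- The reason for which a child is added to a node `x`: to continue the walk promised at `x`, to
meet the data value of `x`, or to be one side of a pair of walks that meet. -/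
inductive Tag (A : Type u) [Fintype A] : Type v
  | cont : Tag A
  | self : Tag A
  | left : List (Point.{u, v} A) → Tag A
  | right : List (Point.{u, v} A) → Tag A

/-- An edge of the canonical tree: the type of the child, the walk from the child that is promised
to end in a given data value, and the reason for the promise. -/
structure Edge (A : Type u) [Fintype A] : Type v where
  /-- The type of the child. -/
  pt : Point.{u, v} A
  /-- The promised walk. -/
  rest : List (Point.{u, v} A)
  /-- The reason. -/
  tag : Tag.{u, v} A

/-- The data values of the canonical tree. -/
inductive Datum (A : Type u) [Fintype A] : Type v
  | init : Datum A
  | own : List (Edge.{u, v} A) → Datum A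
  | fork : List (Edge.{u, v} A) → List (Point.{u, v} A) → List (Point.{u, v} A) → Datum A

/-- The type of a node, given as the list of edges that lead to it, the last edge first. -/
def pt (Γ₀ : Point.{u, v} A) : List (Edge.{u, v} A) → Point.{u, v} A
  | [] => Γ₀
  | e :: _ => e.pt

/-- The walk promised at a node. -/
def rest : List (Edge.{u, v} A) → List (Point.{u, v} A)
  | [] => []
  | e :: _ => e.rest

/-- The data value promised for the last node of the walk promised at a node. -/
def promised : List (Edge.{u, v} A) → Datum.{u, v} A
  | [] => .init
  | ⟨_, _, .cont⟩ :: x => promised x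
  | ⟨_, _, .self⟩ :: x => if rest x = [] then promised x else .own x
  | ⟨Δ, r, .left w⟩ :: x => .fork x (Δ :: r) w
  | ⟨Δ, r, .right w⟩ :: x => .fork x w (Δ :: r)

/-- The data value of a node. -/
def value (x : List (Edge.{u, v} A)) : Datum.{u, v} A :=
  if rest x = [] then promised x else .own x

/-- The edges that leave a node. -/
def Allowed (Γ₀ : Point.{u, v} A) (x : List (Edge.{u, v} A)) : Edge.{u, v} A → Prop
  | ⟨Δ, r, .cont⟩ => rest x = Δ :: r
  | ⟨Δ, r, .self⟩ => Meets (pt Γ₀ x) [] (Δ :: r)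
  | ⟨Δ, r, .left w⟩ => Meets (pt Γ₀ x) (Δ :: r) w
  | ⟨Δ, r, .right w⟩ => Meets (pt Γ₀ x) w (Δ :: r)

/-- The lists of edges that are nodes. -/
def IsNode (Γ₀ : Point.{u, v} A) : List (Edge.{u, v} A) → Prop
  | [] => True
  | e :: x => IsNode Γ₀ x ∧ Allowed Γ₀ x e

/-- The data value originates in the subtree of `x`. -/
def Below (x : List (Edge.{u, v} A)) : Datum.{u, v} A → Prop
  | .init => False
  | .own z => x <:+ z
  | .fork z _ _ => x <:+ z

/-- `Desc Γ₀ w x y`: there is a walk of type `w` from `x` to `y`. -/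
def Desc (Γ₀ : Point.{u, v} A) :
    List (Point.{u, v} A) → List (Edge.{u, v} A) → List (Edge.{u, v} A) → Prop
  | [], x, y => y = x
  | Δ :: w, x, y => ∃ e, Allowed Γ₀ x e ∧ e.pt = Δ ∧ Desc Γ₀ w (e :: x) y

variable {Γ₀ : Point.{u, v} A} {x y z : List (Edge.{u, v} A)} {e e' : Edge.{u, v} A}
  {w : List (Point.{u, v} A)} {d : Datum.{u, v} A}

/-! ### Where data values originate, and why equal values force walks to meet. -/

theorem not_cons_suffix : ¬ e :: x <:+ x := fun h => by
  have := h.length_le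
  simp at this

theorem Below.of_cons (h : Below (e :: x) d) : Below x d := by
  cases d with
  | init => exact h
  | own z => exact (List.suffix_cons _ _).trans h
  | fork z _ _ => exact (List.suffix_cons _ _).trans h

theorem Below.eq_of_cons (h : Below (e :: x) d) (h' : Below (e' :: x) d) : e = e' := by
  have key {z : List (Edge.{u, v} A)} (h : e :: x <:+ z) (h' : e' :: x <:+ z) : e = e' := by
    have := (List.suffix_of_suffix_length_le h h' (by simp)).eq_of_length (by simp)
    simpa using this
  cases d with
  | init => exact h.elim
  | own z => exact key h h'
  | fork z _ _ => exact key h h'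

theorem value_eq : value x = promised x ∧ rest x = [] ∨ value x = .own x ∧ rest x ≠ [] := by
  unfold value
  split_ifs with h <;> simp [h]

/-- The promise made to a child. -/
theorem promised_cons (he : Allowed Γ₀ x e) :
    (promised (e :: x) = promised x ∧ rest x = e.pt :: e.rest) ∨
    (promised (e :: x) = value x ∧ Meets (pt Γ₀ x) [] (e.pt :: e.rest)) ∨
    (∃ v, promised (e :: x) = .fork x (e.pt :: e.rest) v ∧ Meets (pt Γ₀ x) (e.pt :: e.rest) v) ∨
    (∃ v, promised (e :: x) = .fork x v (e.pt :: e.rest) ∧ Meets (pt Γ₀ x) v (e.pt :: e.rest)) := by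
  obtain ⟨Δ, r, _ | _ | v | v⟩ := e
  · exact .inl ⟨rfl, he⟩
  · exact .inr (.inl ⟨rfl, he⟩)
  · exact .inr (.inr (.inl ⟨v, rfl, he⟩))
  · exact .inr (.inr (.inr ⟨v, rfl, he⟩))

/-- A promised value comes from strictly above `x`. It therefore differs from any value created at
`x`, which rules out most cases in the sequel. -/
theorem not_below_promised (hx : IsNode Γ₀ x) : ¬ Below x (promised x) := by
  induction x with
  | nil => exact id
  | cons e x ih =>
    intro h
    rcases promised_cons hx.2 with ⟨h', -⟩ | ⟨h', -⟩ | ⟨v, h', -⟩ | ⟨v, h', -⟩ <;> rw [h'] at h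
    · exact ih hx.1 h.of_cons
    · rcases value_eq (x := x) with ⟨h'', -⟩ | ⟨h'', -⟩ <;> rw [h''] at h
      · exact ih hx.1 h.of_cons
      · exact not_cons_suffix h
    · exact not_cons_suffix h
    · exact not_cons_suffix h

theorem not_below_value (hx : IsNode Γ₀ x) : ¬ Below (e :: x) (value x) := by
  intro h
  rcases value_eq (x := x) with ⟨h', -⟩ | ⟨h', -⟩ <;> rw [h'] at h
  · exact not_below_promised hx h.of_cons
  · exact not_cons_suffix h

theorem not_below_promised_cons (hx : IsNode Γ₀ x) (he : Allowed Γ₀ x e) :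
    ¬ Below (e' :: x) (promised (e :: x)) := by
  intro h
  rcases promised_cons he with ⟨h', -⟩ | ⟨h', -⟩ | ⟨v, h', -⟩ | ⟨v, h', -⟩ <;> rw [h'] at h
  · exact not_below_promised hx h.of_cons
  · exact not_below_value hx h
  · exact not_cons_suffix h
  · exact not_cons_suffix h

/-- The promise at `x` is the only channel by which a value from outside enters the subtree of `x`.
-/
theorem value_desc (h : Desc Γ₀ w x y) : value y = promised x ∨ Below x (value y) := by
  have hval (x : List (Edge.{u, v} A)) : value x = promised x ∨ Below x (value x) := by
    rcases value_eq (x := x) with ⟨h', -⟩ | ⟨h', -⟩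
    · exact .inl h'
    · exact .inr (h' ▸ List.suffix_refl _)
  induction w generalizing x with
  | nil => cases h; exact hval _
  | cons Δ w ih =>
    obtain ⟨e, he, -, h⟩ := h
    rcases ih h with h' | h'
    · rcases promised_cons he with ⟨h'', -⟩ | ⟨h'', -⟩ | ⟨v, h'', -⟩ | ⟨v, h'', -⟩ <;>
        rw [h', h'']
      · exact .inl rfl
      · exact hval x
      · exact .inr (List.suffix_refl _)
      · exact .inr (List.suffix_refl _)
    · exact .inr h'.of_cons

/-- A node in the subtree of `x` with the data value promised at `x` is found at the end of a
prolongation of the promised walk. -/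
theorem prolongs_of_desc (hx : IsNode Γ₀ x) (h : Desc Γ₀ w x y) (hy : value y = promised x) :
    Prolongs (pt Γ₀ x) (rest x) w := by
  induction w generalizing x with
  | nil =>
    obtain rfl : y = x := h
    rcases value_eq (x := y) with ⟨-, h⟩ | ⟨h, -⟩
    · rw [h]; exact ⟨[], rfl, .nil_nil⟩
    · rw [h] at hy
      exact absurd (hy ▸ List.suffix_refl _ : Below y (promised y)) (not_below_promised hx)
  | cons Δ w ih =>
    obtain ⟨e, he, rfl, h⟩ := h
    -- A value from above `x` reaches `y` only through the promise to the child. This leaves a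
    -- `cont` edge, or a `self` edge with `rest x = []`.
    have hyc : promised (e :: x) = promised x := by
      rcases value_desc h with h' | h'
      · rw [← h', hy]
      · rw [hy] at h'; exact absurd h'.of_cons (not_below_promised hx)
    have hp := ih (x := e :: x) ⟨hx, he⟩ h (hy.trans hyc.symm)
    rcases promised_cons he with ⟨-, h'⟩ | ⟨h', hm⟩ | ⟨v, h', -⟩ | ⟨v, h', -⟩
    · obtain ⟨δ, rfl, hδ⟩ := hp
      exact ⟨δ, by rw [h']; rfl, by rw [h']; exact hδ⟩
    · rcases value_eq (x := x) with ⟨-, h''⟩ | ⟨h'', -⟩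
      · rw [h'']
        refine ⟨_, rfl, hm.prolong ?_⟩
        obtain ⟨δ, rfl, hδ⟩ := hp
        exact ⟨δ, rfl, hδ⟩
      · rw [hyc, h''] at h'
        exact absurd (h' ▸ List.suffix_refl _ : Below x (promised x)) (not_below_promised hx)
    · rw [hyc] at h'
      exact absurd (h' ▸ List.suffix_refl _ : Below x (promised x)) (not_below_promised hx)
    · rw [hyc] at h'
      exact absurd (h' ▸ List.suffix_refl _ : Below x (promised x)) (not_below_promised hx)

/-- Meeting itself means that a walk is possible: promises never demand an inconsistent
continuation. -/
theorem meets_rest (hx : IsNode Γ₀ x) : Meets (pt Γ₀ x) (rest x) (rest x) := by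
  induction x with
  | nil => exact .nil_nil
  | cons e x ih =>
    rcases promised_cons hx.2 with ⟨-, h⟩ | ⟨-, h⟩ | ⟨v, -, h⟩ | ⟨v, -, h⟩
    · have := ih hx.1
      rw [h] at this
      exact this.tail
    · exact h.symm.tail
    · exact h.tail
    · exact h.symm.tail

theorem meets_edge (hx : IsNode Γ₀ x) (he : Allowed Γ₀ x e) :
    Meets (pt Γ₀ x) (e.pt :: e.rest) (e.pt :: e.rest) := by
  rcases promised_cons he with ⟨-, h⟩ | ⟨-, h⟩ | ⟨v, -, h⟩ | ⟨v, -, h⟩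
  · exact h ▸ meets_rest hx
  · exact h.right
  · exact h.left
  · exact h.right

theorem value_ne_fork (hx : IsNode Γ₀ x) {w v : List (Point.{u, v} A)} :
    value x ≠ .fork x w v := by
  intro h
  rcases value_eq (x := x) with ⟨h', -⟩ | ⟨h', -⟩
  · exact not_below_promised hx (h' ▸ h ▸ List.suffix_refl _)
  · rw [h'] at h; cases h

theorem promised_ne_fork (hx : IsNode Γ₀ x) {w v : List (Point.{u, v} A)} :
    promised x ≠ .fork x w v := fun h =>
  not_below_promised hx (h ▸ List.suffix_refl _)

theorem promised_ne_value (hx : IsNode Γ₀ x) (h : rest x ≠ []) : promised x ≠ value x := by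
  intro h'
  rcases value_eq (x := x) with ⟨-, h''⟩ | ⟨h'', -⟩
  · exact h h''
  · exact not_below_promised hx (h' ▸ h'' ▸ List.suffix_refl _)

/-- Two children with the same promised data value are promised by walks that meet. -/
theorem meets_of_promised_eq (hx : IsNode Γ₀ x) (he : Allowed Γ₀ x e) (he' : Allowed Γ₀ x e')
    (h : promised (e :: x) = promised (e' :: x)) :
    Meets (pt Γ₀ x) (e.pt :: e.rest) (e'.pt :: e'.rest) := by
  have hrest {e : Edge.{u, v} A} (h : rest x = e.pt :: e.rest) : promised x ≠ value x :=
    promised_ne_value hx (by simp [h])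
  rcases promised_cons he with ⟨h₁, hm⟩ | ⟨h₁, hm⟩ | ⟨v, h₁, hm⟩ | ⟨v, h₁, hm⟩ <;>
  rcases promised_cons he' with ⟨h₂, hm'⟩ | ⟨h₂, hm'⟩ | ⟨v', h₂, hm'⟩ | ⟨v', h₂, hm'⟩ <;>
  rw [h₁, h₂] at h
  · rw [← hm, ← hm']; exact meets_rest hx
  · exact absurd h (hrest hm)
  · exact absurd h (promised_ne_fork hx)
  · exact absurd h (promised_ne_fork hx)
  · exact absurd h.symm (hrest hm')
  · exact hm.trans_nil hm'
  · exact absurd h (value_ne_fork hx)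
  · exact absurd h (value_ne_fork hx)
  · exact absurd h.symm (promised_ne_fork hx)
  · exact absurd h.symm (value_ne_fork hx)
  · simp only [Datum.fork.injEq, true_and] at h
    rw [← h.1]; exact hm.left
  · simp only [Datum.fork.injEq, true_and] at h
    rwa [← h.2]
  · exact absurd h.symm (promised_ne_fork hx)
  · exact absurd h.symm (value_ne_fork hx)
  · simp only [Datum.fork.injEq, true_and] at h
    rw [← h.1]; exact hm.symm
  · simp only [Datum.fork.injEq, true_and] at h
    rw [← h.2]; exact hm.right

theorem meets_nil_of_desc {v : List (Point.{u, v} A)} (hx : IsNode Γ₀ x) (h : Desc Γ₀ v x z)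
    (hz : value x = value z) : Meets (pt Γ₀ x) [] v := by
  cases v with
  | nil => exact .nil_nil
  | cons Δ v =>
    obtain ⟨e, he, rfl, h⟩ := h
    have hzc : value z = promised (e :: x) := by
      rcases value_desc h with h' | h'
      · exact h'
      · rw [← hz] at h'; exact absurd h' (not_below_value hx)
    obtain ⟨δ, rfl, hδ⟩ := prolongs_of_desc (x := e :: x) ⟨hx, he⟩ h hzc
    rw [← hz] at hzc
    rcases promised_cons he with ⟨h', hr⟩ | ⟨-, hm⟩ | ⟨v, h', -⟩ | ⟨v, h', -⟩
    · exact absurd (h'.symm.trans hzc.symm) (promised_ne_value hx (by simp [hr]))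
    · exact hm.prolong ⟨δ, rfl, hδ⟩
    · exact absurd (hzc.trans h') (value_ne_fork hx)
    · exact absurd (hzc.trans h') (value_ne_fork hx)

/-- Along a shared edge, `Meets.cons` reduces to the child. -/
theorem meets_of_desc {v : List (Point.{u, v} A)} (hx : IsNode Γ₀ x) (h : Desc Γ₀ w x y)
    (h' : Desc Γ₀ v x z) (hyz : value y = value z) : Meets (pt Γ₀ x) w v := by
  induction w generalizing x v with
  | nil => cases h; exact meets_nil_of_desc hx h' hyz
  | cons Δ w ih =>
    cases v with
    | nil => cases h'; exact (meets_nil_of_desc hx h hyz.symm).symm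
    | cons Δ' v =>
      obtain ⟨e, he, rfl, h⟩ := h
      obtain ⟨e', he', rfl, h'⟩ := h'
      by_cases hee : e = e'
      · subst hee
        exact (ih (x := e :: x) ⟨hx, he⟩ h h').cons fun a => (meets_edge hx he).head
      -- Once the branches part, the common value cannot originate below both children, nor below
      -- one and be promised to the other. So it is promised to both; the promised walks meet, and
      -- `w` and `v` prolong them.
      · have hd : value y = promised (e :: x) ∧ value z = promised (e' :: x) := by
          rcases value_desc h with h₁ | h₁ <;> rcases value_desc h' with h₂ | h₂
          · exact ⟨h₁, h₂⟩
          · rw [← hyz, h₁] at h₂; exact absurd h₂ (not_below_promised_cons hx he)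
          · rw [hyz, h₂] at h₁; exact absurd h₁ (not_below_promised_cons hx he')
          · rw [hyz] at h₁; exact absurd (h₁.eq_of_cons h₂) hee
        have hm := meets_of_promised_eq hx he he' (hd.1.symm.trans (hyz.trans hd.2))
        obtain ⟨δ, rfl, hδ⟩ := prolongs_of_desc (x := e :: x) ⟨hx, he⟩ h hd.1
        obtain ⟨δ', rfl, hδ'⟩ := prolongs_of_desc (x := e' :: x) ⟨hx, he'⟩ h' hd.2
        exact ((hm.prolong ⟨δ', rfl, hδ'⟩).symm.prolong ⟨δ, rfl, hδ⟩).symm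

theorem exists_desc_rest (x : List (Edge.{u, v} A)) :
    ∃ y, Desc Γ₀ (rest x) x y ∧ value y = promised x := by
  generalize hr : rest x = r
  induction r generalizing x with
  | nil => exact ⟨x, rfl, by rw [value, if_pos hr]⟩
  | cons Δ r ih =>
    obtain ⟨y, h, hy⟩ := ih (⟨Δ, r, .cont⟩ :: x) rfl
    exact ⟨y, ⟨⟨Δ, r, .cont⟩, hr, rfl, h⟩, hy⟩

/-- A `self` edge serves when exactly one walk is empty; otherwise a `left` and a `right` edge share
one `fork` value. `cont` edges then fulfil the promises. -/
theorem exists_desc_of_meets {v : List (Point.{u, v} A)} (h : Meets (pt Γ₀ x) w v) :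
    ∃ y z, Desc Γ₀ w x y ∧ Desc Γ₀ v x z ∧ value y = value z := by
  have key {Δ : Point.{u, v} A} {r : List (Point.{u, v} A)} {t : Tag.{u, v} A}
      (h : Allowed Γ₀ x ⟨Δ, r, t⟩) :
      ∃ y, Desc Γ₀ (Δ :: r) x y ∧ value y = promised (⟨Δ, r, t⟩ :: x) := by
    obtain ⟨y, hy, hv⟩ := exists_desc_rest (Γ₀ := Γ₀) (⟨Δ, r, t⟩ :: x)
    exact ⟨y, ⟨_, h, rfl, hy⟩, hv⟩
  match w, v with
  | [], [] => exact ⟨x, x, rfl, rfl, rfl⟩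
  | [], Δ :: v =>
    obtain ⟨z, hz, hv⟩ := key (t := .self) h
    exact ⟨x, z, rfl, hz, hv.symm⟩
  | Δ :: w, [] =>
    obtain ⟨y, hy, hv⟩ := key (t := .self) h.symm
    exact ⟨y, x, hy, rfl, hv⟩
  | Δ :: w, Δ' :: v =>
    obtain ⟨y, hy, hv⟩ := key (t := .left (Δ' :: v)) h
    obtain ⟨z, hz, hv'⟩ := key (t := .right (Δ :: w)) h
    exact ⟨y, z, hy, hz, hv.trans hv'.symm⟩

theorem Desc.isNode (h : Desc Γ₀ w x y) (hx : IsNode Γ₀ x) : IsNode Γ₀ y := by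
  induction w generalizing x with
  | nil => cases h; exact hx
  | cons Δ w ih => obtain ⟨e, he, -, h⟩ := h; exact ih h ⟨hx, he⟩

theorem Desc.pt_eq (h : Desc Γ₀ w x y) : pt Γ₀ y = (pt Γ₀ x).endpoint w := by
  induction w generalizing x with
  | nil => cases h; rfl
  | cons Δ w ih => obtain ⟨e, he, rfl, h⟩ := h; exact ih h

theorem desc_append {v : List (Point.{u, v} A)} :
    Desc Γ₀ (w ++ v) x z ↔ ∃ y, Desc Γ₀ w x y ∧ Desc Γ₀ v y z := by
  induction w generalizing x with
  | nil => simp [Desc]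
  | cons Δ w ih =>
    simp only [List.cons_append, Desc, ih]
    grind

theorem Desc.exists_append (h : Desc Γ₀ w x y) :
    ∃ l : List (Edge.{u, v} A), y = l ++ x ∧ w = (l.map Edge.pt).reverse := by
  induction w generalizing x with
  | nil => exact ⟨[], h, rfl⟩
  | cons Δ w ih =>
    obtain ⟨e, he, rfl, h⟩ := h
    obtain ⟨l, rfl, rfl⟩ := ih h
    exact ⟨l ++ [e], by simp, by simp⟩

theorem Desc.walk_unique {v : List (Point.{u, v} A)} (h : Desc Γ₀ w x y) (h' : Desc Γ₀ v x y) :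
    w = v := by
  obtain ⟨l, rfl, rfl⟩ := h.exists_append
  obtain ⟨l', hl, rfl⟩ := h'.exists_append
  rw [List.append_cancel_right hl]

end CanonicalTree

/-! ### The truth lemma and completeness. -/

section Completeness

open CanonicalTree

variable {A : Type u} [Fintype A]

/-- The canonical data tree with a root of type `Γ₀`. -/
noncomputable def canonicalTree (Γ₀ : Point.{u, v} A) : DataTree.{u, v} A where
  Node := {x : List (Edge.{u, v} A) // IsNode Γ₀ x}
  Child x y := ∃ e, y.1 = e :: x.1
  root := ⟨[], trivial⟩
  not_child_root := by rintro x ⟨e, h⟩; cases h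
  existsUnique_parent := by
    rintro ⟨_ | ⟨e, y⟩, hy⟩ h
    · exact absurd rfl h
    · refine ⟨⟨y, hy.1⟩, ⟨e, rfl⟩, ?_⟩
      rintro ⟨z, hz⟩ ⟨e', h'⟩
      cases h'
      rfl
  reachable := by
    rintro ⟨x, hx⟩
    induction x with
    | nil => exact .refl
    | cons e x ih => exact (ih hx.1).tail ⟨e, rfl⟩
  lab x := (pt Γ₀ x.1).lab
  data := Setoid.ker fun x => value x.1

namespace CanonicalTree

variable {Γ₀ : Point.{u, v} A}

theorem truth (s : Kind) (P : Expr A s) : match s, P with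
    | .node, φ => ∀ x : (canonicalTree Γ₀).Node,
      x ∈ ((canonicalTree Γ₀).eval φ : Set (canonicalTree Γ₀).Node) ↔ φ.toClass ∈ pt Γ₀ x.1
    | .path, α => ∀ x y : (canonicalTree Γ₀).Node,
      (x, y) ∈ ((canonicalTree Γ₀).eval α :
        Set ((canonicalTree Γ₀).Node × (canonicalTree Γ₀).Node)) ↔
      ∃ w, Desc Γ₀ w x.1 y.1 ∧ Match α (pt Γ₀ x.1) w := by
  have heqDia (α β : PathExpr A) (x : (canonicalTree Γ₀).Node) :
      (∃ y z : (canonicalTree Γ₀).Node,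
        (∃ w, Desc Γ₀ w x.1 y.1 ∧ Match α (pt Γ₀ x.1) w) ∧
        (∃ v, Desc Γ₀ v x.1 z.1 ∧ Match β (pt Γ₀ x.1) v) ∧ value y.1 = value z.1) ↔
      eqDia α.toClass β.toClass ∈ pt Γ₀ x.1 := by
    rw [eqDia_mem_iff]
    constructor
    · rintro ⟨y, z, ⟨w, hw, hw'⟩, ⟨v, hv, hv'⟩, h⟩
      exact ⟨w, v, hw', hv', meets_of_desc x.2 hw hv h⟩
    · rintro ⟨w, v, hw, hv, h⟩
      obtain ⟨y, z, hy, hz, h⟩ := exists_desc_of_meets h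
      exact ⟨⟨y, hy.isNode x.2⟩, ⟨z, hz.isNode x.2⟩, ⟨w, hy, hw⟩, ⟨v, hz, hv⟩, h⟩
  induction P with
  | eps =>
    intro x y
    change x = y ↔ _
    constructor
    · rintro rfl; exact ⟨[], rfl, .eps⟩
    · rintro ⟨w, hw, h⟩; cases h; exact Subtype.ext hw.symm
  | down =>
    intro x y
    change (∃ e, y.1 = e :: x.1) ↔ _
    constructor
    · rintro ⟨e, h⟩
      exact ⟨[e.pt], ⟨e, (h ▸ y.2 : IsNode Γ₀ (e :: x.1)).2, rfl, h⟩, .down _⟩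
    · rintro ⟨w, hw, h⟩
      cases h
      obtain ⟨e, -, -, h⟩ := hw
      exact ⟨e, h⟩
  | test φ ih =>
    intro x y
    change x = y ∧ x ∈ ((canonicalTree Γ₀).eval φ : Set (canonicalTree Γ₀).Node) ↔ _
    rw [ih]
    constructor
    · rintro ⟨rfl, h⟩; exact ⟨[], rfl, .test h⟩
    · rintro ⟨w, hw, h⟩
      cases h with
      | test h => exact ⟨Subtype.ext hw.symm, h⟩
  | union α β ihα ihβ =>
    intro x y
    refine (or_congr (ihα x y) (ihβ x y)).trans ?_
    constructor
    · rintro (⟨w, hw, h⟩ | ⟨w, hw, h⟩)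
      · exact ⟨w, hw, .union_left h⟩
      · exact ⟨w, hw, .union_right h⟩
    · rintro ⟨w, hw, h⟩
      cases h with
      | union_left h => exact .inl ⟨w, hw, h⟩
      | union_right h => exact .inr ⟨w, hw, h⟩
  | seq α β ihα ihβ =>
    intro x y
    refine (exists_congr fun z => and_congr (ihα x z) (ihβ z y)).trans ?_
    constructor
    · rintro ⟨z, ⟨w, hw, h⟩, ⟨v, hv, h'⟩⟩
      exact ⟨w ++ v, desc_append.2 ⟨_, hw, hv⟩, .seq h (hw.pt_eq ▸ h')⟩
    · rintro ⟨w, hw, h⟩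
      cases h with
      | seq h h' =>
        obtain ⟨z, hz, hz'⟩ := desc_append.1 hw
        exact ⟨⟨z, hz.isNode x.2⟩, ⟨_, hz, h⟩, ⟨_, hz', hz.pt_eq ▸ h'⟩⟩
  | label a => intro x; exact Point.lab_eq_iff
  | neg φ ih =>
    intro x
    change ¬ x ∈ ((canonicalTree Γ₀).eval φ : Set (canonicalTree Γ₀).Node) ↔ _
    rw [ih, toClass_neg, Point.compl_mem_iff]
  | and φ ψ ih₁ ih₂ =>
    intro x
    refine (and_congr (ih₁ x) (ih₂ x)).trans ?_
    rw [toClass_and, Point.inf_mem_iff]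
  | dia α ih =>
    intro x
    refine (exists_congr fun y => ih x y).trans ?_
    -- By `eqAx6`, `⟨α⟩` is treated as `⟨α = α⟩`.
    rw [← dia_toClass, ← eqDia_self, ← heqDia]
    exact ⟨fun ⟨y, h⟩ => ⟨y, y, h, h, rfl⟩, fun ⟨y, _, h, _⟩ => ⟨y, h⟩⟩
  | eqDia α β ihα ihβ =>
    intro x
    refine Iff.trans ?_ (heqDia α β x)
    exact exists_congr fun y => exists_congr fun z =>
      and_congr (ihα x y) (and_congr (ihβ x z) Iff.rfl)

end CanonicalTree

theorem SemEquiv.derivable_node {φ ψ : NodeExpr A} (h : SemEquiv.{u, v} φ ψ) :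
    Derivable XPMinus φ ψ := by
  rw [← toClass_eq]
  have key {φ ψ : NodeExpr A} (h : SemEquiv.{u, v} φ ψ) : φ.toClass ≤ ψ.toClass := by
    by_contra hn
    obtain ⟨Γ, hφ, hΓ⟩ := Point.exists_of_ideal.{u, v} (fun a => a ≤ ψ.toClass) bot_le
      (fun h h' => sup_le h h') (fun h h' => h.trans h') hn
    have hφ' := (truth (Γ₀ := Γ) .node φ (canonicalTree Γ).root).2 hφ
    rw [h] at hφ'
    exact hΓ _ ((truth (Γ₀ := Γ) .node ψ (canonicalTree Γ).root).1 hφ') le_rfl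
  exact le_antisymm (key h) (key fun T => (h T).symm)

theorem SemEquiv.derivable_path {α β : PathExpr A} (h : SemEquiv.{u, v} α β) :
    Derivable XPMinus α β := by
  rw [← toClass_eq]
  have key {α β : PathExpr A} (h : SemEquiv.{u, v} α β) : α.toClass ≤ β.toClass := by
    by_contra hn
    have hI : IsPathIdeal fun x => x ≤ β.toClass :=
      { zero := bot_le
        add := fun h h' => by rw [add_eq_sup]; exact sup_le h h'
        mono := fun h h' => h.trans h' }
    obtain ⟨Γ, w, hw, hΓ⟩ := hI.exists_match.{u, v} hn
    -- The walk is possible at `Γ`: otherwise `[¬⟨p⟩]p = 0` for an approximation `p`, and `0` is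
    -- below `β`.
    have hm : Meets Γ w w := .of_dia fun χs hχ => by
      by_contra hd
      refine hΓ _ (Point.compl_mem_iff.2 hd) χs hχ ?_
      have h0 := mul_test_compl_mul 1 (walk χs)
      rw [one_mul] at h0
      rw [h0]
      exact bot_le
    obtain ⟨y, -, hy, -⟩ := exists_desc_of_meets (Γ₀ := Γ) (x := []) hm
    have hα := (truth (Γ₀ := Γ) .path α (canonicalTree Γ).root ⟨y, hy.isNode trivial⟩).2
      ⟨w, hy, hw⟩
    rw [h] at hα
    obtain ⟨v, hv, hβ⟩ := (truth (Γ₀ := Γ) .path β (canonicalTree Γ).root _).1 hα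
    -- The end node determines the walk, so `β` matches `w` itself and lies above one of its
    -- approximations.
    obtain rfl := hy.walk_unique hv
    obtain ⟨a, ha, χs, hχ, hle⟩ := hβ.exists_le
    exact hΓ a ha χs hχ hle
  exact le_antisymm (key h) (key fun T => (h T).symm)

end Completeness

theorem theorem3p6 {A : Type u} [Fintype A] :
    (∀ φ ψ : NodeExpr A, Derivable XPMinus φ ψ ↔ SemEquiv.{u, v} φ ψ) ∧
    (∀ α β : PathExpr A, Derivable XPMinus α β ↔ SemEquiv.{u, v} α β) :=
  ⟨fun _ _ => ⟨Derivable.semEquiv, SemEquiv.derivable_node⟩,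
    fun _ _ => ⟨Derivable.semEquiv, SemEquiv.derivable_path⟩⟩
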